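/- Let $a,b,L,\alpha_1,\alpha_2>0$ and put $X_0=L^2(0,L)\times L^2(0,L)$ (real valued), with $\|(\eta,u)\|_{X_0}^2=\|\eta\|_{L^2(0,L)}^2+\|u\|_{L^2(0,L)}^2$. Consider the operator $$A(\eta,u)=(-u_x+au_{xxx}-bu_{xxxxx},\,-\eta_x+a\eta_{xxx}-b\eta_{xxxxx}),$$ $$D(A)=\{(\eta,u)\in[H^5(0,L)\cap H^2_0(0,L)]^2:\ u_{xx}(0)+\alpha_1\eta_{xx}(0)=0,\ u_{xx}(L)-\alpha_2\eta_{xx}(L)=0\}$$ in $X_0$. Let $(\eta_0,u_0)\in X_0$ and let $(\eta,u)\in C([0,\infty);X_0)$ be the mild solution of $\frac{d}{dt}(\eta,u)=A(\eta,u)$, $(\eta,u)(0)=(\eta_0,u_0)$, that is, for all $t\ge 0$, $$\int_0^t(\eta,u)(s)\,ds\in D(A)\quad\text{and}\quad (\eta,u)(t)=(\eta_0,u_0)+A\int_0^t(\eta,u)(s)\,ds .$$ For $x\in\{0,L\}$ the boundary trace $\eta_{xx}(x,\cdot)$ is the (a.e. unique) locally integrable function with $\int_0^t\eta_{xx}(x,s)\,ds=\big(\int_0^t\eta(s)\,ds\big)_{xx}(x)$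 for all $t\ge0$. Then the traces $\eta_{xx}(0,\cdot)$ and $\eta_{xx}(L,\cdot)$ exist, belong to $L^2(0,T)$ for every $T>0$, and for every $T>0$ $$\frac12\|(\eta_0,u_0)\|^2_{X_0}-\frac12\|(\eta(T),u(T))\|^2_{X_0}=\int_0^T\left(\alpha_2 b|\eta_{xx}(L,t)|^2+\alpha_1 b|\eta_{xx}(0,t)|^2\right)dt$$ and $$\frac T2\|(\eta_0,u_0)\|^2_{X_0}=\frac12\int_0^T\|(\eta(t),u(t))\|_{X_0}^2\,dt+\alpha_2 b\int_0^T(T-t)|\eta_{xx}(L,t)|^2dt+\alpha_1 b\int_0^T(T-t)|\eta_{xx}(0,t)|^2dt .$$ Furthermore $(\eta,u)\in L^2(0,T;X_2)$, where $X_2=[H^2_0(0,L)]^2$ carries the norm $\|(\eta,u)\|_{X_2}^2=\sum_{k=0}^2\|(\partial_x^k\eta,\partial_x^ku)\|_{X_0}^2$ of $[H^2(0,L)]^2$, and $$\|(\eta,u)\|_{L^2(0,T;X_2)}\le C\,\|(\eta_0,u_0)\|_{X_0},$$ where the constant $C>0$ depends only on $a,b,T,L$ and $\alpha_2$ (not on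 $\alpha_1$ or $(\eta_0,u_0)$). -/

import Mathlib

open MeasureTheory Set
open scoped ContDiff ENNReal

noncomputable section

namespace DampedBoussinesq

/-- The real Hilbert space `L²(0,L)`. -/
abbrev L2 (L : ℝ) : Type := Lp ℝ 2 (volume.restrict (Ioo (0 : ℝ) L))

/-- `X₀ = L²(0,L) × L²(0,L)` with `‖(η,u)‖² = ‖η‖² + ‖u‖²`. -/
abbrev X0 (L : ℝ) : Type := WithLp 2 (L2 L × L2 L)

variable {L : ℝ}

/-- `g ∈ L²(0,L)` is the `k`-th weak derivative of `f ∈ L²(0,L)` on the interval `(0,L)`. -/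
def IsWeakDeriv (k : ℕ) (f g : L2 L) : Prop :=
  ∀ φ : ℝ → ℝ, ContDiff ℝ ∞ φ → HasCompactSupport φ → tsupport φ ⊆ Ioo 0 L →
    ∫ x in Ioo 0 L, f x * iteratedDeriv k φ x = (-1) ^ k * ∫ x in Ioo 0 L, g x * φ x

/-- A function has at most one `k`-th weak derivative. -/
theorem IsWeakDeriv.unique {k : ℕ} {f g h : L2 L} (hg : IsWeakDeriv k f g)
    (hh : IsWeakDeriv k f h) : g = h := by
  have hgi : Integrable (g : ℝ → ℝ) (volume.restrict (Ioo (0 : ℝ) L)) :=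
    (Lp.memLp g).integrable one_le_two
  have hhi : Integrable (h : ℝ → ℝ) (volume.restrict (Ioo (0 : ℝ) L)) :=
    (Lp.memLp h).integrable one_le_two
  have key : ∀ᵐ x ∂(volume : Measure ℝ), x ∈ Ioo 0 L → (g x - h x) = 0 := by
    refine isOpen_Ioo.ae_eq_zero_of_integral_contDiff_smul_eq_zero
      (f := fun x => g x - h x) ?_ ?_
    · exact IntegrableOn.locallyIntegrableOn (hgi.sub hhi)
    · intro φ hφ hc hs
      have e : (-1 : ℝ) ^ k * ∫ x in Ioo 0 L, g x * φ x
          = (-1 : ℝ) ^ k * ∫ x in Ioo 0 L, h x * φ x :=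
        (hg φ hφ hc hs).symm.trans (hh φ hφ hc hs)
      have e' := mul_left_cancel₀ (pow_ne_zero k (by norm_num)) e
      obtain ⟨M, hM⟩ := hc.exists_bound_of_continuous hφ.continuous
      have ig : Integrable (fun x => g x * φ x) (volume.restrict (Ioo (0 : ℝ) L)) :=
        hgi.mul_bdd (c := M) hφ.continuous.aestronglyMeasurable (Filter.Eventually.of_forall hM)
      have ih : Integrable (fun x => h x * φ x) (volume.restrict (Ioo (0 : ℝ) L)) :=
        hhi.mul_bdd (c := M) hφ.continuous.aestronglyMeasurable (Filter.Eventually.of_forall hM)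
      have e2 : ∫ x in Ioo 0 L, φ x * (g x - h x) = 0 := by
        have : ∫ x in Ioo 0 L, φ x * (g x - h x)
            = ∫ x in Ioo 0 L, (g x * φ x - h x * φ x) := by
          congr 1; ext x; ring
        rw [this, integral_sub ig ih, e', sub_self]
      refine Eq.trans (Eq.symm ?_) e2
      refine setIntegral_eq_integral_of_forall_compl_eq_zero ?_
      intro x hx
      have : φ x = 0 := image_eq_zero_of_notMem_tsupport (fun h => hx (hs h))
      simp [this]
  refine Lp.ext ?_
  rw [Filter.EventuallyEq, ae_restrict_iff' measurableSet_Ioo]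
  filter_upwards [key] with x hx hxm
  exact sub_eq_zero.mp (hx hxm)

/-- Membership in the Sobolev space `H^m(0,L)`. -/
def MemSobolev (m : ℕ) (f : L2 L) : Prop := ∀ k ≤ m, ∃ g : L2 L, IsWeakDeriv k f g

open Classical in
/-- The `k`-th weak derivative `∂ₓᵏ f ∈ L²(0,L)` (with the value `0` if there is none). -/
def weakDeriv (k : ℕ) (f : L2 L) : L2 L :=
  if h : ∃ g : L2 L, IsWeakDeriv k f g then h.choose else 0

theorem IsWeakDeriv.weakDeriv_eq {k : ℕ} {f g : L2 L} (h : IsWeakDeriv k f g) :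
    weakDeriv k f = g := by
  have hex : ∃ g : L2 L, IsWeakDeriv k f g := ⟨g, h⟩
  rw [weakDeriv, dif_pos hex]
  exact hex.choose_spec.unique h

/-- `f ∈ L²(0,L)` has a representative that is continuous on `[0,L]` and takes the value `c`
at `x`. -/
def HasPointValue (f : L2 L) (x c : ℝ) : Prop :=
  ∃ F : ℝ → ℝ, ContinuousOn F (Icc 0 L) ∧
    (∀ᵐ s ∂(volume.restrict (Ioo (0 : ℝ) L)), F s = f s) ∧ F x = c

/-- The value at a point of `[0,L]` does not depend on the continuous representative. -/
theorem HasPointValue.unique {f : L2 L} {x c d : ℝ} (hL : 0 < L) (hx : x ∈ Icc 0 L)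
    (hc : HasPointValue f x c) (hd : HasPointValue f x d) : c = d := by
  obtain ⟨F, hF, hFf, rfl⟩ := hc
  obtain ⟨G, hG, hGf, rfl⟩ := hd
  have h1 : F =ᵐ[volume.restrict (Ioo (0 : ℝ) L)] G := by
    filter_upwards [hFf, hGf] with s h1 h2
    rw [h1, h2]
  have h2 : EqOn F G (Ioo 0 L) :=
    Measure.eqOn_open_of_ae_eq h1 isOpen_Ioo (hF.mono Ioo_subset_Icc_self)
      (hG.mono Ioo_subset_Icc_self)
  exact h2.of_subset_closure hF hG Ioo_subset_Icc_self (by rw [closure_Ioo hL.ne]) hx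

open Classical in
/-- The boundary value `f(x)`, `x ∈ {0,L}`, of `f ∈ H¹(0,L)`, that is the value at `x` of its
continuous representative (with the value `0` if there is no such representative). -/
def pointValue (f : L2 L) (x : ℝ) : ℝ :=
  if h : ∃ c : ℝ, HasPointValue f x c then h.choose else 0

theorem HasPointValue.pointValue_eq {f : L2 L} {x c : ℝ} (hL : 0 < L) (hx : x ∈ Icc 0 L)
    (h : HasPointValue f x c) : pointValue f x = c := by
  have hex : ∃ c : ℝ, HasPointValue f x c := ⟨c, h⟩
  rw [pointValue, dif_pos hex]
  exact hex.choose_spec.unique hL hx h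

/-- Membership in `H²₀(0,L)`: `f ∈ H²(0,L)` with `f = fₓ = 0` at both end points. -/
structure MemH20 (f : L2 L) : Prop where
  memSobolev : MemSobolev 2 f
  value_left : pointValue f 0 = 0
  value_right : pointValue f L = 0
  deriv_left : pointValue (weakDeriv 1 f) 0 = 0
  deriv_right : pointValue (weakDeriv 1 f) L = 0

/-- Membership of `(η,u)` in the domain `D(A)` of the operator of the damped system. -/
structure MemDomain (α₁ α₂ : ℝ) (y : X0 L) : Prop where
  memH20_fst : MemH20 y.fst
  memH20_snd : MemH20 y.snd
  memSobolev_fst : MemSobolev 5 y.fst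
  memSobolev_snd : MemSobolev 5 y.snd
  feedback_left :
    pointValue (weakDeriv 2 y.snd) 0 + α₁ * pointValue (weakDeriv 2 y.fst) 0 = 0
  feedback_right :
    pointValue (weakDeriv 2 y.snd) L - α₂ * pointValue (weakDeriv 2 y.fst) L = 0

/-- `A(η,u) = (-uₓ + a uₓₓₓ - b uₓₓₓₓₓ, -ηₓ + a ηₓₓₓ - b ηₓₓₓₓₓ)` (used on `D(A)` only). -/
def opA (a b : ℝ) (y : X0 L) : X0 L :=
  WithLp.toLp 2
    (-weakDeriv 1 y.snd + a • weakDeriv 3 y.snd - b • weakDeriv 5 y.snd,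
     -weakDeriv 1 y.fst + a • weakDeriv 3 y.fst - b • weakDeriv 5 y.fst)

/-- `y = (η,u) : [0,∞) → X₀` is the mild solution of `dy/dt = A y`, `y(0) = y₀`: it is continuous
and, for all `t ≥ 0`, `∫₀ᵗ y ds ∈ D(A)` and `y(t) = y₀ + A ∫₀ᵗ y ds`. As `A` generates a
`C₀`-semigroup `S`, this says that `y(t) = S(t) y₀` for all `t ≥ 0`. -/
structure IsMildSolution (a b α₁ α₂ : ℝ) (y₀ : X0 L) (y : ℝ → X0 L) : Prop where
  continuousOn : ContinuousOn y (Ici 0)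
  integral_mem : ∀ t, 0 ≤ t → MemDomain α₁ α₂ (∫ s in (0 : ℝ)..t, y s)
  eq_add : ∀ t, 0 ≤ t → y t = y₀ + opA a b (∫ s in (0 : ℝ)..t, y s)

/-- `g` is the boundary trace `t ↦ ηₓₓ(x,t)` of a mild solution `y = (η,u)`, `x ∈ {0,L}`.
For merely `L²` initial data, `ηₓₓ(t)` need not have a value at `x` for a given `t`; the trace is
understood in the sense of distributions in time: `∫₀ᵗ η ds` belongs to `H⁵(0,L)`, so that its
second derivative has a value at `x`, and `g` is locally integrable with
`(∫₀ᵗ η ds)ₓₓ(x) = ∫₀ᵗ g ds` for all `t ≥ 0`. This determines `g` almost everywhere on `(0,∞)`, is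
the usual value for initial data in `D(A)`, and is stable under limits in `X₀` of such data. -/
def IsSecondDerivTrace (y : ℝ → X0 L) (x : ℝ) (g : ℝ → ℝ) : Prop :=
  ∀ t, 0 ≤ t → IntervalIntegrable g volume 0 t ∧
    pointValue (weakDeriv 2 (∫ s in (0 : ℝ)..t, y s).fst) x = ∫ s in (0 : ℝ)..t, g s

/-- The `2`-jet `((η,u), (ηₓ,uₓ), (ηₓₓ,uₓₓ))`; for `(η,u) ∈ H²(0,L)²` its norm is
the `H²(0,L)²` norm of `(η,u)`. -/
def jet2 (y : X0 L) : PiLp 2 (fun _ : Fin 3 => X0 L) :=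
  WithLp.toLp 2 fun k => WithLp.toLp 2 (weakDeriv (k : ℕ) y.fst, weakDeriv (k : ℕ) y.snd)

/-- `y ∈ L²(0,T;X₂)`, where `X₂ = H²₀(0,L) × H²₀(0,L)` carries the norm of `H²(0,L)²`. As `jet2`
is an isometry of `X₂` onto a closed subspace, this is Bochner square integrability of `y` in
`X₂`, and the norm is `eLpNorm (fun t => jet2 (y t)) 2` over `(0,T)`. -/
def MemL2X2 (T : ℝ) (y : ℝ → X0 L) : Prop :=
  (∀ᵐ t ∂(volume.restrict (Ioo 0 T)), MemH20 (y t).fst ∧ MemH20 (y t).snd) ∧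
    MemLp (fun t => jet2 (y t)) 2 (volume.restrict (Ioo 0 T))

/-- The norm of `y` in `L²(0,T;X₂)`. -/
def normL2X2 (T : ℝ) (y : ℝ → X0 L) : ℝ :=
  (eLpNorm (fun t => jet2 (y t)) 2 (volume.restrict (Ioo 0 T))).toReal

end DampedBoussinesq

end

open DampedBoussinesq

/-!
The damped problem is dissipative, and its traces and its smoothing effect come from two quadratic
identities on `D(A)`, both obtained by integration by parts:

* `inner_generator_self`: `⟪A y, y⟫ = -(α₂ b |ηₓₓ(L)|² + α₁ b |ηₓₓ(0)|²)`;
* `inner_generator_multiplier`: with the multiplier `M (η, u) = (x u, x η)`, the quantity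
  `⟪A y, M y⟫` equals `½ ‖y‖² + (3a/2) ‖yₓ‖² + (5b/2) ‖yₓₓ‖²` minus a multiple of `|ηₓₓ(L)|²`, which
  the first identity controls.

Each of the maps `N = ηₓₓ(0), ηₓₓ(L), (y, yₓ, yₓₓ)` on `D(A)` therefore satisfies
`‖N v‖² ≤ ⟪A v, S v⟫` with a bounded symmetric operator `S` on `X₀`. This inequality is used twice.
It shows that `N` is bounded for the graph norm of `A`, without elliptic regularity. Along a
solution `w` that takes its values in `D(A)`, where `⟪A w, S w⟫` is the time derivative of
`½ ⟪w, S w⟫`, it bounds the norm of `N w` in `L²(0,∞)` by the norm of `w(0)`.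

To reach a mild solution `y` no semigroup is needed: with `Y(t) = ∫₀ᵗ y`, which lies in `D(A)`, the
time averages `(Y(t + h) - Y(t)) / h` are strict solutions, as are their differences, and they
converge to `y`. Hence `N` of the averages converges in `L²(0,∞)` (`IsMildPair.exists_trace`); the
limit is the time derivative of `N Y` (`IsMildPair.integral_trace_eq`), which is the definition of
the boundary trace. The energy identity passes to the limit, and integrating it in time gives the
identity with the weight `T - t`. For the jet, `H²₀(0,L)` is closed (`memH20_of_tendsto`), so that
the limit is the jet of `y(t)` for almost every `t`. The multiplier and the boundary term at `L` do
not involve `α₁`, so neither does the constant.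

On the interval, functions of `H¹(0,L)` are handled through absolutely continuous representatives
(`HasACDeriv`), which a weak derivative provides by the du Bois-Reymond lemma; each integration by
parts is then the fundamental theorem of calculus for one explicit primitive.
-/

open DampedBoussinesq

namespace DampedBoussinesq

open Filter Topology
open scoped RealInnerProductSpace

/-! ### Absolutely continuous functions on an interval -/

/-- `F` is absolutely continuous on `[0,L]` and its almost everywhere derivative is `f`. -/
structure HasACDeriv (L : ℝ) (F f : ℝ → ℝ) : Prop where
  ac : AbsolutelyContinuousOnInterval F 0 L
  ae_hasDerivAt : ∀ᵐ x ∂(volume.restrict (Ioo (0 : ℝ) L)), HasDerivAt F (f x) x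

namespace HasACDeriv

variable {L : ℝ} {F G f g : ℝ → ℝ}

theorem continuousOn (h : HasACDeriv L F f) (hL : 0 < L) : ContinuousOn F (Icc 0 L) := by
  simpa [uIcc_of_le hL.le] using h.ac.continuousOn

theorem congr_ae (h : HasACDeriv L F f) (hfg : f =ᵐ[volume.restrict (Ioo (0 : ℝ) L)] g) :
    HasACDeriv L F g :=
  ⟨h.ac, by filter_upwards [h.ae_hasDerivAt, hfg] with x hx hxy; rwa [← hxy]⟩

theorem add (hF : HasACDeriv L F f) (hG : HasACDeriv L G g) :
    HasACDeriv L (fun x => F x + G x) (fun x => f x + g x) :=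
  ⟨hF.ac.add hG.ac, by
    filter_upwards [hF.ae_hasDerivAt, hG.ae_hasDerivAt] with x h1 h2 using h1.add h2⟩

theorem sub (hF : HasACDeriv L F f) (hG : HasACDeriv L G g) :
    HasACDeriv L (fun x => F x - G x) (fun x => f x - g x) :=
  ⟨hF.ac.sub hG.ac, by
    filter_upwards [hF.ae_hasDerivAt, hG.ae_hasDerivAt] with x h1 h2 using h1.sub h2⟩

theorem const_mul (c : ℝ) (hF : HasACDeriv L F f) :
    HasACDeriv L (fun x => c * F x) (fun x => c * f x) :=
  ⟨hF.ac.const_mul c, by filter_upwards [hF.ae_hasDerivAt] with x h1 using h1.const_mul c⟩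

theorem mul (hF : HasACDeriv L F f) (hG : HasACDeriv L G g) :
    HasACDeriv L (fun x => F x * G x) (fun x => f x * G x + F x * g x) :=
  ⟨hF.ac.fun_mul hG.ac, by
    filter_upwards [hF.ae_hasDerivAt, hG.ae_hasDerivAt] with x h1 h2 using h1.mul h2⟩

theorem of_contDiff (hF : ContDiff ℝ ∞ F) : HasACDeriv L F (deriv F) :=
  ⟨(hF.of_le (by simp)).contDiffOn.absolutelyContinuousOnInterval, Eventually.of_forall fun x =>
    ((hF.differentiable (by simp)) x).hasDerivAt⟩

theorem primitive (hL : 0 < L) (hf : Integrable f (volume.restrict (Ioo (0 : ℝ) L))) (c : ℝ) :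
    HasACDeriv L (fun x => c + ∫ s in (0 : ℝ)..x, f s) f := by
  have hi : IntervalIntegrable f volume 0 L :=
    (intervalIntegrable_iff_integrableOn_Ioo_of_le hL.le).2 hf
  refine ⟨?_, ?_⟩
  · have h1 := hi.absolutelyContinuousOnInterval_intervalIntegral (c := 0) (by simp)
    have h2 : AbsolutelyContinuousOnInterval (fun _ : ℝ => c) 0 L :=
      (of_contDiff (L := L) (contDiff_const (c := c))).ac
    exact h2.add h1
  · rw [ae_restrict_iff' measurableSet_Ioo]
    filter_upwards [hi.ae_hasDerivAt_integral] with x hx hxm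
    refine (hx ?_ 0 (by simp)).const_add c
    rw [uIcc_of_le hL.le]
    exact Ioo_subset_Icc_self hxm

/-- The fundamental theorem of calculus. -/
theorem integral_eq (hL : 0 < L) (h : HasACDeriv L F f) :
    ∫ x in Ioo 0 L, f x = F L - F 0 := by
  rw [← h.ac.integral_deriv_eq_sub, intervalIntegral.integral_of_le hL.le,
    integral_Ioc_eq_integral_Ioo]
  refine integral_congr_ae ?_
  filter_upwards [h.ae_hasDerivAt] with x hx using hx.deriv.symm

end HasACDeriv

/-! ### Weak derivatives and boundary values -/

variable {L : ℝ}

theorem integrable_coe_L2 (f : L2 L) :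
    Integrable (f : ℝ → ℝ) (volume.restrict (Ioo (0 : ℝ) L)) :=
  (Lp.memLp f).integrable one_le_two

theorem integrable_coe_mul_of_continuous (f : L2 L) {φ : ℝ → ℝ} (hφ : Continuous φ) :
    Integrable (fun x => f x * φ x) (volume.restrict (Ioo (0 : ℝ) L)) := by
  obtain ⟨M, hM⟩ := isCompact_Icc.exists_bound_of_continuousOn (s := Icc 0 L) hφ.continuousOn
  refine (integrable_coe_L2 f).mul_bdd (c := M) hφ.aestronglyMeasurable ?_
  filter_upwards [ae_restrict_mem measurableSet_Ioo] with x hx using hM x (Ioo_subset_Icc_self hx)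

/-- The integration by parts formula between an absolutely continuous representative and a smooth
function. -/
theorem integral_mul_deriv_add (hL : 0 < L) {f g : L2 L} {F φ : ℝ → ℝ} (hF : HasACDeriv L F g)
    (hFf : F =ᵐ[volume.restrict (Ioo (0 : ℝ) L)] f) (hφ : ContDiff ℝ ∞ φ) :
    (∫ x in Ioo 0 L, f x * deriv φ x) + ∫ x in Ioo 0 L, g x * φ x
      = F L * φ L - F 0 * φ 0 := by
  rw [← (hF.mul (HasACDeriv.of_contDiff hφ)).integral_eq hL, ← integral_add
    (integrable_coe_mul_of_continuous f (hφ.continuous_deriv (by simp)))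
    (integrable_coe_mul_of_continuous g hφ.continuous)]
  refine integral_congr_ae ?_
  filter_upwards [hFf] with x hx
  rw [hx]; ring

/-- A smooth function compactly supported in `(0,L)` with vanishing integral is the derivative of
another such function. -/
theorem exists_deriv_eq_of_integral_eq_zero (hL : 0 < L) {ψ : ℝ → ℝ} (hψ : ContDiff ℝ ∞ ψ)
    (hc : HasCompactSupport ψ) (hs : tsupport ψ ⊆ Ioo 0 L) (h0 : ∫ x, ψ x = 0) :
    ∃ φ : ℝ → ℝ, ContDiff ℝ ∞ φ ∧ HasCompactSupport φ ∧ tsupport φ ⊆ Ioo 0 L ∧ deriv φ = ψ := by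
  have hd : ∀ x, HasDerivAt (fun x => ∫ s in (0 : ℝ)..x, ψ s) (ψ x) x := fun x =>
    intervalIntegral.integral_hasDerivAt_right (hψ.continuous.intervalIntegrable _ _)
      (hψ.continuous.stronglyMeasurableAtFilter _ _) hψ.continuous.continuousAt
  have hder : deriv (fun x => ∫ s in (0 : ℝ)..x, ψ s) = ψ := funext fun x => (hd x).deriv
  have hcd : ContDiff ℝ ∞ (fun x => ∫ s in (0 : ℝ)..x, ψ s) := by
    rw [contDiff_infty_iff_deriv, hder]
    exact ⟨fun x => (hd x).differentiableAt, hψ⟩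
  -- The support of `ψ` lies in a compact interval `[p, q] ⊆ (0, L)`.
  obtain ⟨p, q, hp, hq, hpq⟩ : ∃ p q : ℝ, 0 < p ∧ q < L ∧ tsupport ψ ⊆ Icc p q := by
    rcases (tsupport ψ).eq_empty_or_nonempty with he | hne
    · exact ⟨1, L - 1, one_pos, by linarith, by simp [he]⟩
    · obtain ⟨p, hp, hp'⟩ := hc.isCompact.exists_isLeast hne
      obtain ⟨q, hq, hq'⟩ := hc.isCompact.exists_isGreatest hne
      exact ⟨p, q, (hs hp).1, (hs hq).2, fun x hx => ⟨hp' hx, hq' hx⟩⟩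
  have hz : ∀ x, x ∉ Icc p q → ψ x = 0 := fun x hx =>
    image_eq_zero_of_notMem_tsupport fun h => hx (hpq h)
  have hsupp : Function.support (fun x => ∫ s in (0 : ℝ)..x, ψ s) ⊆ Icc p q := by
    intro x hx
    by_contra hxn
    apply hx
    rw [mem_Icc, not_and_or, not_le, not_le] at hxn
    have hzero : ∀ u v : ℝ, (∀ s ∈ uIcc u v, s ∉ Icc p q) → ∫ s in u..v, ψ s = 0 := by
      intro u v huv
      rw [intervalIntegral.integral_congr (g := fun _ => 0) fun s hs => hz s (huv s hs)]
      simp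
    rcases hxn with hxp | hxq
    · refine hzero 0 x fun s hs hsm => ?_
      have := hs.2
      have h2 : max 0 x < p := max_lt hp hxp
      linarith [hsm.1]
    · -- Beyond `q` the primitive is the full integral.
      have h1 : ∫ s in (0 : ℝ)..(max x L), ψ s = 0 := by
        rw [intervalIntegral.integral_of_le (hL.le.trans (le_max_right _ _))]
        refine Eq.trans (setIntegral_eq_integral_of_forall_compl_eq_zero
          fun s hs => hz s fun hsm => hs ?_) h0
        exact ⟨hp.trans_le hsm.1, hsm.2.trans (hxq.le.trans (le_max_left _ _))⟩
      have h2 : ∫ s in x..(max x L), ψ s = 0 := by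
        refine hzero _ _ fun s hs hsm => ?_
        have := hs.1
        rw [min_eq_left (le_max_left _ _)] at this
        linarith [hsm.2]
      have h3 := intervalIntegral.integral_add_adjacent_intervals
        (hψ.continuous.intervalIntegrable (μ := volume) 0 x)
        (hψ.continuous.intervalIntegrable x (max x L))
      show ∫ s in (0 : ℝ)..x, ψ s = 0
      linarith
  refine ⟨_, hcd, ?_, ?_, hder⟩
  · exact HasCompactSupport.of_support_subset_isCompact isCompact_Icc hsupp
  · exact (closure_minimal hsupp isClosed_Icc).trans fun x hx => ⟨hp.trans_le hx.1, hx.2.trans_lt hq⟩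

/-- The du Bois-Reymond lemma: a function whose weak derivative vanishes is constant. -/
theorem ae_eq_const_of_integral_mul_deriv_eq_zero (hL : 0 < L) {h : ℝ → ℝ}
    (hi : Integrable h (volume.restrict (Ioo (0 : ℝ) L)))
    (hd : ∀ φ : ℝ → ℝ, ContDiff ℝ ∞ φ → HasCompactSupport φ → tsupport φ ⊆ Ioo 0 L →
      ∫ x in Ioo 0 L, h x * deriv φ x = 0) :
    ∃ c : ℝ, h =ᵐ[volume.restrict (Ioo (0 : ℝ) L)] fun _ => c := by
  -- A smooth bump with integral one supported in `(0, L)`.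
  let B : ContDiffBump (L / 2) := ⟨L / 8, L / 4, by positivity, by linarith⟩
  have hBs : tsupport (B.normed volume) ⊆ Ioo 0 L := by
    rw [B.tsupport_normed_eq, Real.closedBall_eq_Icc]
    intro x hx
    have h1 : L / 2 - L / 4 ≤ x := hx.1
    have h2 : x ≤ L / 2 + L / 4 := hx.2
    exact ⟨by linarith, by linarith⟩
  have hBc : ContDiff ℝ ∞ (B.normed volume) := B.contDiff_normed
  have hBi : ∫ x, B.normed volume x = 1 := B.integral_normed
  have hBk : HasCompactSupport (B.normed volume) := B.hasCompactSupport_normed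
  set c : ℝ := ∫ x in Ioo 0 L, h x * B.normed volume x with hc
  have hmul : ∀ ψ : ℝ → ℝ, Continuous ψ → HasCompactSupport ψ →
      Integrable (fun x => h x * ψ x) (volume.restrict (Ioo (0 : ℝ) L)) := by
    intro ψ hψ hk
    obtain ⟨M, hM⟩ := hk.exists_bound_of_continuous hψ
    exact hi.mul_bdd (c := M) hψ.aestronglyMeasurable (Eventually.of_forall hM)
  refine ⟨c, ?_⟩
  have key : ∀ᵐ x ∂(volume : Measure ℝ), x ∈ Ioo 0 L → h x - c = 0 := by
    refine isOpen_Ioo.ae_eq_zero_of_integral_contDiff_smul_eq_zero (f := fun x => h x - c) ?_ ?_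
    · exact IntegrableOn.locallyIntegrableOn (hi.sub (integrable_const c))
    · intro ψ hψ hk hs
      set m : ℝ := ∫ x, ψ x with hm
      obtain ⟨φ, h1, h2, h3, h4⟩ := exists_deriv_eq_of_integral_eq_zero hL
        (ψ := fun x => ψ x - m * B.normed volume x)
        (hψ.sub (contDiff_const.mul hBc)) (hk.sub hBk.mul_left)
        ((tsupport_sub _ _).trans (union_subset hs ((tsupport_mul_subset_right).trans hBs))) (by
          rw [integral_sub (hψ.continuous.integrable_of_hasCompactSupport hk)
            ((hBc.continuous.integrable_of_hasCompactSupport hBk).const_mul m),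
            integral_const_mul, hBi, mul_one, sub_self])
      have h5 := hd φ h1 h2 h3
      rw [h4] at h5
      have h6 : ∫ x in Ioo 0 L, h x * (ψ x - m * B.normed volume x)
          = (∫ x in Ioo 0 L, h x * ψ x) - m * c := by
        rw [hc, ← integral_const_mul, ← integral_sub (hmul ψ hψ.continuous hk)
          ((hmul _ hBc.continuous hBk).const_mul m)]
        congr 1; ext x; ring
      have h7 : m = ∫ x in Ioo 0 L, ψ x := by
        refine (setIntegral_eq_integral_of_forall_compl_eq_zero fun x hx => ?_).symm
        exact image_eq_zero_of_notMem_tsupport fun h => hx (hs h)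
      have h8 : ∫ x, ψ x • (h x - c) = ∫ x in Ioo 0 L, ψ x • (h x - c) := by
        refine (setIntegral_eq_integral_of_forall_compl_eq_zero fun x hx => ?_).symm
        have : ψ x = 0 := image_eq_zero_of_notMem_tsupport fun h => hx (hs h)
        simp [this]
      have h9 : ∫ x in Ioo 0 L, ψ x • (h x - c)
          = (∫ x in Ioo 0 L, h x * ψ x) - c * ∫ x in Ioo 0 L, ψ x := by
        rw [← integral_const_mul, ← integral_sub (hmul ψ hψ.continuous hk)
          (((hψ.continuous.integrable_of_hasCompactSupport hk).restrict).const_mul c)]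
        congr 1; ext x; simp only [smul_eq_mul]; ring
      rw [h8, h9, ← h7]
      linarith
  rw [EventuallyEq, ae_restrict_iff' measurableSet_Ioo]
  filter_upwards [key] with x hx hxm using sub_eq_zero.1 (hx hxm)

/-- A function with a weak derivative in `L²` has an absolutely continuous representative. -/
theorem IsWeakDeriv.exists_hasACDeriv (hL : 0 < L) {f g : L2 L} (h : IsWeakDeriv 1 f g) :
    ∃ F : ℝ → ℝ, HasACDeriv L F g ∧ F =ᵐ[volume.restrict (Ioo (0 : ℝ) L)] f := by
  have hG := HasACDeriv.primitive hL (integrable_coe_L2 g) 0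
  set G : ℝ → ℝ := fun x => 0 + ∫ s in (0 : ℝ)..x, g s with hGdef
  have hGi : Integrable G (volume.restrict (Ioo (0 : ℝ) L)) :=
    ((hG.continuousOn hL).integrableOn_Icc).mono_set Ioo_subset_Icc_self
  obtain ⟨c, hc⟩ := ae_eq_const_of_integral_mul_deriv_eq_zero hL
    (h := fun x => f x - G x) ((integrable_coe_L2 f).sub hGi) (by
      intro φ h1 h2 h3
      have hφ' : Continuous (deriv φ) := h1.continuous_deriv (by simp)
      have e1 := h φ h1 h2 h3
      rw [iteratedDeriv_one, pow_one] at e1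
      have e2 := (hG.mul (HasACDeriv.of_contDiff h1)).integral_eq hL
      have hz : ∀ x, x ∉ Ioo 0 L → φ x = 0 := fun x hx =>
        image_eq_zero_of_notMem_tsupport fun h => hx (h3 h)
      rw [hz L (by simp), hz 0 (by simp), mul_zero, mul_zero, sub_zero] at e2
      obtain ⟨M, hM⟩ := isCompact_Icc.exists_bound_of_continuousOn (s := Icc 0 L)
        hφ'.continuousOn
      have hGφ : Integrable (fun x => G x * deriv φ x) (volume.restrict (Ioo (0 : ℝ) L)) := by
        refine hGi.mul_bdd (c := M) hφ'.aestronglyMeasurable ?_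
        filter_upwards [ae_restrict_mem measurableSet_Ioo] with x hx
          using hM x (Ioo_subset_Icc_self hx)
      rw [integral_add (integrable_coe_mul_of_continuous g h1.continuous) hGφ] at e2
      have e3 : ∫ x in Ioo 0 L, (f x - G x) * deriv φ x
          = (∫ x in Ioo 0 L, f x * deriv φ x) - ∫ x in Ioo 0 L, G x * deriv φ x := by
        rw [← integral_sub (integrable_coe_mul_of_continuous f hφ') hGφ]
        congr 1; ext x; ring
      rw [e3]; linarith)
  refine ⟨_, HasACDeriv.primitive hL (integrable_coe_L2 g) c, ?_⟩
  filter_upwards [hc] with x hx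
  simp only [hGdef] at hx
  linarith

theorem HasACDeriv.hasPointValue (hL : 0 < L) {f : L2 L} {F g : ℝ → ℝ} (hF : HasACDeriv L F g)
    (hFf : F =ᵐ[volume.restrict (Ioo (0 : ℝ) L)] f) (x : ℝ) : HasPointValue f x (F x) :=
  ⟨F, hF.continuousOn hL, hFf, rfl⟩

theorem IsWeakDeriv.zero (f : L2 L) : IsWeakDeriv 0 f f := by
  intro φ _ _ _
  simp

theorem IsWeakDeriv.add {k : ℕ} {f g f' g' : L2 L} (hf : IsWeakDeriv k f f')
    (hg : IsWeakDeriv k g g') : IsWeakDeriv k (f + g) (f' + g') := by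
  intro φ h1 h2 h3
  have hadd : ∀ (p q : L2 L) (ψ : ℝ → ℝ), Continuous ψ → ∫ x in Ioo 0 L, (p + q : L2 L) x * ψ x
      = (∫ x in Ioo 0 L, p x * ψ x) + ∫ x in Ioo 0 L, q x * ψ x := by
    intro p q ψ hψ
    rw [← integral_add (integrable_coe_mul_of_continuous p hψ)
      (integrable_coe_mul_of_continuous q hψ)]
    refine integral_congr_ae ?_
    filter_upwards [Lp.coeFn_add p q] with x hx
    rw [hx, Pi.add_apply, add_mul]
  rw [hadd _ _ _ (h1.continuous_iteratedDeriv k (by exact_mod_cast le_top)),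
    hadd _ _ _ h1.continuous, hf φ h1 h2 h3, hg φ h1 h2 h3, mul_add]

theorem IsWeakDeriv.smul {k : ℕ} {f f' : L2 L} (c : ℝ) (hf : IsWeakDeriv k f f') :
    IsWeakDeriv k (c • f) (c • f') := by
  intro φ h1 h2 h3
  have hsm : ∀ (p : L2 L) (ψ : ℝ → ℝ), ∫ x in Ioo 0 L, (c • p : L2 L) x * ψ x
      = c * ∫ x in Ioo 0 L, p x * ψ x := by
    intro p ψ
    rw [← integral_const_mul]
    refine integral_congr_ae ?_
    filter_upwards [Lp.coeFn_smul c p] with x hx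
    rw [hx, Pi.smul_apply, smul_eq_mul, mul_assoc]
  rw [hsm, hsm, hf φ h1 h2 h3, mul_left_comm]

/-- Consecutive weak derivatives are weak derivatives of each other. -/
theorem IsWeakDeriv.succ {k : ℕ} {f g g' : L2 L} (hg : IsWeakDeriv k f g)
    (hg' : IsWeakDeriv (k + 1) f g') : IsWeakDeriv 1 g g' := by
  intro φ h1 h2 h3
  have e1 := hg (deriv φ) (contDiff_infty_iff_deriv.1 h1).2 h2.deriv
    ((tsupport_deriv_subset (𝕜 := ℝ)).trans h3)
  have e2 := hg' φ h1 h2 h3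
  rw [← iteratedDeriv_succ', e2] at e1
  rw [iteratedDeriv_one]
  have h0 : ((-1 : ℝ) ^ k) ≠ 0 := pow_ne_zero k (by norm_num)
  apply mul_left_cancel₀ h0
  rw [← e1]; ring

theorem MemSobolev.isWeakDeriv {m k : ℕ} {f : L2 L} (h : MemSobolev m f) (hk : k ≤ m) :
    IsWeakDeriv k f (weakDeriv k f) := by
  obtain ⟨g, hg⟩ := h k hk
  rwa [hg.weakDeriv_eq]

theorem weakDeriv_zero (f : L2 L) : weakDeriv 0 f = f := (IsWeakDeriv.zero f).weakDeriv_eq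

theorem MemSobolev.exists_hasACDeriv (hL : 0 < L) {m k : ℕ} {f : L2 L} (h : MemSobolev m f)
    (hk : k + 1 ≤ m) : ∃ F : ℝ → ℝ, HasACDeriv L F (weakDeriv (k + 1) f) ∧
      F =ᵐ[volume.restrict (Ioo (0 : ℝ) L)] weakDeriv k f :=
  ((h.isWeakDeriv (Nat.le_of_succ_le hk)).succ (h.isWeakDeriv hk)).exists_hasACDeriv hL

theorem MemSobolev.add {m : ℕ} {f g : L2 L} (hf : MemSobolev m f) (hg : MemSobolev m g) :
    MemSobolev m (f + g) := fun _ hk => ⟨_, (hf.isWeakDeriv hk).add (hg.isWeakDeriv hk)⟩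

theorem MemSobolev.smul {m : ℕ} {f : L2 L} (c : ℝ) (hf : MemSobolev m f) :
    MemSobolev m (c • f) := fun _ hk => ⟨_, (hf.isWeakDeriv hk).smul c⟩

theorem MemSobolev.weakDeriv_add {m k : ℕ} {f g : L2 L} (hf : MemSobolev m f)
    (hg : MemSobolev m g) (hk : k ≤ m) :
    weakDeriv k (f + g) = weakDeriv k f + weakDeriv k g :=
  ((hf.isWeakDeriv hk).add (hg.isWeakDeriv hk)).weakDeriv_eq

theorem MemSobolev.weakDeriv_smul {m k : ℕ} {f : L2 L} (c : ℝ) (hf : MemSobolev m f)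
    (hk : k ≤ m) : weakDeriv k (c • f) = c • weakDeriv k f :=
  ((hf.isWeakDeriv hk).smul c).weakDeriv_eq

theorem HasPointValue.add {f g : L2 L} {x c d : ℝ} (hf : HasPointValue f x c)
    (hg : HasPointValue g x d) : HasPointValue (f + g) x (c + d) := by
  obtain ⟨F, hF, hFf, rfl⟩ := hf
  obtain ⟨G, hG, hGg, rfl⟩ := hg
  refine ⟨F + G, hF.add hG, ?_, rfl⟩
  filter_upwards [hFf, hGg, Lp.coeFn_add f g] with s h1 h2 h3
  rw [h3, Pi.add_apply, Pi.add_apply, h1, h2]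

theorem HasPointValue.smul {f : L2 L} {x c : ℝ} (a : ℝ) (hf : HasPointValue f x c) :
    HasPointValue (a • f) x (a * c) := by
  obtain ⟨F, hF, hFf, rfl⟩ := hf
  refine ⟨fun s => a * F s, continuousOn_const.mul hF, ?_, rfl⟩
  filter_upwards [hFf, Lp.coeFn_smul a f] with s h1 h3
  rw [h3, Pi.smul_apply, h1, smul_eq_mul]

theorem MemSobolev.hasPointValue (hL : 0 < L) {m k : ℕ} {f : L2 L} (h : MemSobolev m f)
    (hk : k + 1 ≤ m) {x : ℝ} (hx : x ∈ Icc 0 L) :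
    HasPointValue (weakDeriv k f) x (pointValue (weakDeriv k f) x) := by
  obtain ⟨F, hF, hFf⟩ := h.exists_hasACDeriv hL hk
  have := hF.hasPointValue hL hFf x
  rwa [this.pointValue_eq hL hx]

theorem MemSobolev.pointValue_add (hL : 0 < L) {m k : ℕ} {f g : L2 L} (hf : MemSobolev m f)
    (hg : MemSobolev m g) (hk : k + 1 ≤ m) {x : ℝ} (hx : x ∈ Icc 0 L) :
    pointValue (weakDeriv k (f + g)) x
      = pointValue (weakDeriv k f) x + pointValue (weakDeriv k g) x := by
  rw [hf.weakDeriv_add hg (Nat.le_of_succ_le hk)]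
  exact ((hf.hasPointValue hL hk hx).add (hg.hasPointValue hL hk hx)).pointValue_eq hL hx

theorem MemSobolev.pointValue_smul (hL : 0 < L) {m k : ℕ} {f : L2 L} (c : ℝ)
    (hf : MemSobolev m f) (hk : k + 1 ≤ m) {x : ℝ} (hx : x ∈ Icc 0 L) :
    pointValue (weakDeriv k (c • f)) x = c * pointValue (weakDeriv k f) x := by
  rw [hf.weakDeriv_smul c (Nat.le_of_succ_le hk)]
  exact ((hf.hasPointValue hL hk hx).smul c).pointValue_eq hL hx

/-- `g` is the weak derivative of `f` and `f` vanishes at both end points, expressed by testing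
against all smooth functions on the line, without any condition at the end points. In this form
the property visibly passes to limits in `L²`. -/
def IsWeakDerivZero (f g : L2 L) : Prop :=
  ∀ φ : ℝ → ℝ, ContDiff ℝ ∞ φ →
    (∫ x in Ioo 0 L, f x * deriv φ x) + ∫ x in Ioo 0 L, g x * φ x = 0

theorem IsWeakDerivZero.isWeakDeriv {f g : L2 L} (h : IsWeakDerivZero f g) :
    IsWeakDeriv 1 f g := by
  intro φ h1 _ _
  rw [iteratedDeriv_one]
  linarith [h φ h1]

theorem isWeakDerivZero_iff (hL : 0 < L) {f g : L2 L} :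
    IsWeakDerivZero f g ↔ IsWeakDeriv 1 f g ∧ pointValue f 0 = 0 ∧ pointValue f L = 0 := by
  constructor
  · intro h
    obtain ⟨F, hF, hFf⟩ := h.isWeakDeriv.exists_hasACDeriv hL
    -- The test functions `x` and `L - x` isolate the two boundary values.
    have e1 := integral_mul_deriv_add hL hF hFf (φ := fun x => x) contDiff_id
    have e2 := integral_mul_deriv_add hL hF hFf (φ := fun x => L - x)
      (contDiff_const.sub contDiff_id)
    rw [h (fun x => x) contDiff_id] at e1
    rw [h (fun x => L - x) (contDiff_const.sub contDiff_id)] at e2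
    have h0 : F 0 = 0 := by
      have : F 0 * L = 0 := by linarith
      exact (mul_eq_zero.1 this).resolve_right hL.ne'
    have h1 : F L = 0 := by
      have : F L * L = 0 := by linarith
      exact (mul_eq_zero.1 this).resolve_right hL.ne'
    refine ⟨h.isWeakDeriv, ?_, ?_⟩
    · rw [(hF.hasPointValue hL hFf 0).pointValue_eq hL (by simp [hL.le]), h0]
    · rw [(hF.hasPointValue hL hFf L).pointValue_eq hL (by simp [hL.le]), h1]
  · rintro ⟨h, h0, h1⟩ φ hφ
    obtain ⟨F, hF, hFf⟩ := h.exists_hasACDeriv hL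
    rw [(hF.hasPointValue hL hFf 0).pointValue_eq hL (by simp [hL.le])] at h0
    rw [(hF.hasPointValue hL hFf L).pointValue_eq hL (by simp [hL.le])] at h1
    rw [integral_mul_deriv_add hL hF hFf hφ, h0, h1]
    ring

/-- Testing against a continuous function is continuous on `L²`. -/
theorem tendsto_integral_mul {ι : Type*} {l : Filter ι} {f : ι → L2 L} {f₀ : L2 L}
    (h : Tendsto f l (𝓝 f₀)) {φ : ℝ → ℝ} (hφ : Continuous φ) :
    Tendsto (fun i => ∫ x in Ioo 0 L, f i x * φ x) l (𝓝 (∫ x in Ioo 0 L, f₀ x * φ x)) := by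
  have hm : MemLp φ 2 (volume.restrict (Ioo (0 : ℝ) L)) := by
    obtain ⟨M, hM⟩ := isCompact_Icc.exists_bound_of_continuousOn (s := Icc 0 L) hφ.continuousOn
    refine MemLp.of_bound hφ.aestronglyMeasurable M ?_
    filter_upwards [ae_restrict_mem measurableSet_Ioo] with x hx
      using hM x (Ioo_subset_Icc_self hx)
  have e : ∀ g : L2 L, ∫ x in Ioo 0 L, g x * φ x = ⟪hm.toLp φ, g⟫ := by
    intro g
    rw [L2.inner_def]
    refine integral_congr_ae ?_
    filter_upwards [hm.coeFn_toLp] with x hx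
    rw [hx]; simp
  simp_rw [e]
  exact tendsto_const_nhds.inner h

theorem IsWeakDerivZero.of_tendsto {ι : Type*} {l : Filter ι} [l.NeBot] {f g : ι → L2 L}
    {f₀ g₀ : L2 L} (h : ∀ i, IsWeakDerivZero (f i) (g i)) (hf : Tendsto f l (𝓝 f₀))
    (hg : Tendsto g l (𝓝 g₀)) : IsWeakDerivZero f₀ g₀ := by
  intro φ hφ
  have h1 := (tendsto_integral_mul hf (hφ.continuous_deriv (by simp))).add
    (tendsto_integral_mul hg hφ.continuous)
  refine tendsto_nhds_unique h1 ?_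
  simp_rw [fun i => h i φ hφ]
  exact tendsto_const_nhds

theorem MemH20.isWeakDerivZero (hL : 0 < L) {f : L2 L} (h : MemH20 f) :
    IsWeakDerivZero f (weakDeriv 1 f) ∧ IsWeakDerivZero (weakDeriv 1 f) (weakDeriv 2 f) :=
  ⟨(isWeakDerivZero_iff hL).2 ⟨h.memSobolev.isWeakDeriv (by norm_num), h.value_left,
      h.value_right⟩,
    (isWeakDerivZero_iff hL).2 ⟨(h.memSobolev.isWeakDeriv (by norm_num)).succ
      (h.memSobolev.isWeakDeriv le_rfl), h.deriv_left, h.deriv_right⟩⟩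

theorem memH20_of_isWeakDerivZero (hL : 0 < L) {f g₁ g₂ : L2 L} (h₁ : IsWeakDerivZero f g₁)
    (h₂ : IsWeakDerivZero g₁ g₂) :
    MemH20 f ∧ weakDeriv 1 f = g₁ ∧ weakDeriv 2 f = g₂ := by
  obtain ⟨d1, v1, v2⟩ := (isWeakDerivZero_iff hL).1 h₁
  obtain ⟨d2, v3, v4⟩ := (isWeakDerivZero_iff hL).1 h₂
  have d3 : IsWeakDeriv 2 f g₂ := by
    intro φ c1 c2 c3
    have e1 := d1 (deriv φ) (contDiff_infty_iff_deriv.1 c1).2 c2.deriv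
      ((tsupport_deriv_subset (𝕜 := ℝ)).trans c3)
    have e2 := d2 φ c1 c2 c3
    rw [← iteratedDeriv_succ', ← iteratedDeriv_one, e2] at e1
    rw [e1]; ring
  refine ⟨⟨?_, v1, v2, ?_, ?_⟩, d1.weakDeriv_eq, d3.weakDeriv_eq⟩
  · intro k hk
    interval_cases k
    · exact ⟨f, IsWeakDeriv.zero f⟩
    · exact ⟨_, d1⟩
    · exact ⟨_, d3⟩
  · rw [d1.weakDeriv_eq, v3]
  · rw [d1.weakDeriv_eq, v4]

/-- `H²₀(0,L)` is closed: a limit in `L²` along which the first two derivatives converge stays in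
`H²₀(0,L)`, and its derivatives are the limits. -/
theorem memH20_of_tendsto (hL : 0 < L) {ι : Type*} {l : Filter ι} [l.NeBot] {f : ι → L2 L}
    {f₀ g₁ g₂ : L2 L} (h : ∀ i, MemH20 (f i)) (hf : Tendsto f l (𝓝 f₀))
    (h₁ : Tendsto (fun i => weakDeriv 1 (f i)) l (𝓝 g₁))
    (h₂ : Tendsto (fun i => weakDeriv 2 (f i)) l (𝓝 g₂)) :
    MemH20 f₀ ∧ weakDeriv 1 f₀ = g₁ ∧ weakDeriv 2 f₀ = g₂ :=
  memH20_of_isWeakDerivZero hL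
    (IsWeakDerivZero.of_tendsto (fun i => ((h i).isWeakDerivZero hL).1) hf h₁)
    (IsWeakDerivZero.of_tendsto (fun i => ((h i).isWeakDerivZero hL).2) h₁ h₂)

theorem MemH20.add (hL : 0 < L) {f g : L2 L} (hf : MemH20 f) (hg : MemH20 g) :
    MemH20 (f + g) := by
  have h0 : (0 : ℝ) ∈ Icc 0 L := by simp [hL.le]
  have h1 : L ∈ Icc 0 L := by simp [hL.le]
  have z : ∀ x ∈ Icc 0 L, pointValue (f + g) x = pointValue f x + pointValue g x := by
    intro x hx
    simpa [weakDeriv_zero] using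
      hf.memSobolev.pointValue_add hL hg.memSobolev (k := 0) (by norm_num) hx
  refine ⟨hf.memSobolev.add hg.memSobolev, ?_, ?_, ?_, ?_⟩
  · rw [z 0 h0, hf.value_left, hg.value_left, add_zero]
  · rw [z L h1, hf.value_right, hg.value_right, add_zero]
  · rw [hf.memSobolev.pointValue_add hL hg.memSobolev (by norm_num) h0, hf.deriv_left,
      hg.deriv_left, add_zero]
  · rw [hf.memSobolev.pointValue_add hL hg.memSobolev (by norm_num) h1, hf.deriv_right,
      hg.deriv_right, add_zero]

theorem MemH20.smul (hL : 0 < L) {f : L2 L} (c : ℝ) (hf : MemH20 f) : MemH20 (c • f) := by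
  have h0 : (0 : ℝ) ∈ Icc 0 L := by simp [hL.le]
  have h1 : L ∈ Icc 0 L := by simp [hL.le]
  have z : ∀ x ∈ Icc 0 L, pointValue (c • f) x = c * pointValue f x := by
    intro x hx
    simpa [weakDeriv_zero] using hf.memSobolev.pointValue_smul hL c (k := 0) (by norm_num) hx
  refine ⟨hf.memSobolev.smul c, ?_, ?_, ?_, ?_⟩
  · rw [z 0 h0, hf.value_left, mul_zero]
  · rw [z L h1, hf.value_right, mul_zero]
  · rw [hf.memSobolev.pointValue_smul hL c (by norm_num) h0, hf.deriv_left, mul_zero]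
  · rw [hf.memSobolev.pointValue_smul hL c (by norm_num) h1, hf.deriv_right, mul_zero]

theorem integral_zero_mul (ψ : ℝ → ℝ) : ∫ x in Ioo 0 L, (0 : L2 L) x * ψ x = 0 := by
  rw [integral_congr_ae (g := fun _ => 0), integral_zero]
  filter_upwards [Lp.coeFn_zero ℝ 2 (volume.restrict (Ioo (0 : ℝ) L))] with x hx
  rw [hx, Pi.zero_apply, zero_mul]

theorem isWeakDeriv_zero_zero (k : ℕ) : IsWeakDeriv k (0 : L2 L) 0 := fun φ _ _ _ => by
  rw [integral_zero_mul, integral_zero_mul, mul_zero]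

theorem memSobolev_zero (m : ℕ) : MemSobolev m (0 : L2 L) := fun k _ =>
  ⟨0, isWeakDeriv_zero_zero k⟩

theorem memH20_zero (hL : 0 < L) : MemH20 (0 : L2 L) := by
  refine (memH20_of_isWeakDerivZero hL (g₁ := 0) (g₂ := 0) ?_ ?_).1 <;>
    exact fun φ _ => by rw [integral_zero_mul, integral_zero_mul, add_zero]

/-! ### Integration by parts in `H⁵ ∩ H²₀` -/

/-- Representatives of a function of `H⁵(0,L) ∩ H²₀(0,L)` and of its first five derivatives. -/
structure IsJetRep (p : L2 L) (P : ℕ → ℝ → ℝ) : Prop where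
  hasACDeriv : ∀ k < 5, HasACDeriv L (P k) (P (k + 1))
  ae_eq : ∀ k ≤ 5, P k =ᵐ[volume.restrict (Ioo (0 : ℝ) L)] weakDeriv k p
  zero_left : P 0 0 = 0
  zero_right : P 0 L = 0
  one_left : P 1 0 = 0
  one_right : P 1 L = 0
  two_left : P 2 0 = pointValue (weakDeriv 2 p) 0
  two_right : P 2 L = pointValue (weakDeriv 2 p) L

theorem exists_isJetRep (hL : 0 < L) {p : L2 L} (hs : MemSobolev 5 p) (h0 : MemH20 p) :
    ∃ P : ℕ → ℝ → ℝ, IsJetRep p P := by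
  have hex : ∀ k : ℕ, ∃ F : ℝ → ℝ, (k < 5 → HasACDeriv L F (weakDeriv (k + 1) p)) ∧
      F =ᵐ[volume.restrict (Ioo (0 : ℝ) L)] weakDeriv k p := by
    intro k
    by_cases hk : k < 5
    · obtain ⟨F, h1, h2⟩ := hs.exists_hasACDeriv hL (k := k) hk
      exact ⟨F, fun _ => h1, h2⟩
    · exact ⟨weakDeriv k p, fun h => absurd h hk, ae_eq_rfl⟩
  choose P hP hPe using hex
  have hv : ∀ k < 5, ∀ x ∈ Icc 0 L, P k x = pointValue (weakDeriv k p) x := fun k hk x hx =>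
    (((hP k hk).hasPointValue hL (hPe k) x).pointValue_eq hL hx).symm
  have m0 : (0 : ℝ) ∈ Icc 0 L := by simp [hL.le]
  have m1 : L ∈ Icc 0 L := by simp [hL.le]
  refine ⟨P, ⟨fun k hk => (hP k hk).congr_ae (hPe (k + 1)).symm, fun k _ => hPe k,
    ?_, ?_, ?_, ?_, ?_, ?_⟩⟩
  · rw [hv 0 (by norm_num) 0 m0, weakDeriv_zero, h0.value_left]
  · rw [hv 0 (by norm_num) L m1, weakDeriv_zero, h0.value_right]
  · rw [hv 1 (by norm_num) 0 m0, h0.deriv_left]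
  · rw [hv 1 (by norm_num) L m1, h0.deriv_right]
  · rw [hv 2 (by norm_num) 0 m0]
  · rw [hv 2 (by norm_num) L m1]

theorem inner_eq_integral {f g : L2 L} {F G : ℝ → ℝ}
    (hF : F =ᵐ[volume.restrict (Ioo (0 : ℝ) L)] f)
    (hG : G =ᵐ[volume.restrict (Ioo (0 : ℝ) L)] g) : ⟪f, g⟫ = ∫ x in Ioo 0 L, F x * G x := by
  rw [L2.inner_def]
  refine integral_congr_ae ?_
  filter_upwards [hF, hG] with x h1 h2
  rw [h1, h2]; simp [mul_comm]

theorem integrable_mul_of_ae_eq {f g : L2 L} {F G : ℝ → ℝ}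
    (hF : F =ᵐ[volume.restrict (Ioo (0 : ℝ) L)] f)
    (hG : G =ᵐ[volume.restrict (Ioo (0 : ℝ) L)] g) :
    Integrable (fun x => F x * G x) (volume.restrict (Ioo (0 : ℝ) L)) :=
  ((memLp_congr_ae hF).2 (Lp.memLp f)).integrable_mul ((memLp_congr_ae hG).2 (Lp.memLp g))

theorem memLp_id_mul (f : L2 L) :
    MemLp (fun x => x * f x) 2 (volume.restrict (Ioo (0 : ℝ) L)) ∧
      ∀ᵐ x ∂(volume.restrict (Ioo (0 : ℝ) L)), ‖x * f x‖ ≤ L * ‖f x‖ := by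
  have hb : ∀ᵐ x ∂(volume.restrict (Ioo (0 : ℝ) L)), ‖x * f x‖ ≤ L * ‖f x‖ := by
    filter_upwards [ae_restrict_mem measurableSet_Ioo] with x hx
    rw [norm_mul, Real.norm_of_nonneg hx.1.le]
    exact mul_le_mul_of_nonneg_right hx.2.le (norm_nonneg _)
  exact ⟨(Lp.memLp f).of_le_mul (continuous_id.aestronglyMeasurable.mul
    (Lp.aestronglyMeasurable f)) hb, hb⟩

/-- Multiplication by the coordinate `x`, as a bounded operator on `L²(0,L)`. -/
noncomputable def mulCoord (L : ℝ) : L2 L →L[ℝ] L2 L :=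
  LinearMap.mkContinuous
    { toFun := fun f => (memLp_id_mul f).1.toLp _
      map_add' := fun f g => by
        refine Lp.ext ?_
        filter_upwards [(memLp_id_mul (f + g)).1.coeFn_toLp,
          (memLp_id_mul f).1.coeFn_toLp, (memLp_id_mul g).1.coeFn_toLp,
          Lp.coeFn_add f g, Lp.coeFn_add ((memLp_id_mul f).1.toLp _)
            ((memLp_id_mul g).1.toLp _)] with x h1 h2 h3 h4 h5
        rw [h1, h5, Pi.add_apply, h2, h3, h4, Pi.add_apply, mul_add]
      map_smul' := fun c f => by
        refine Lp.ext ?_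
        filter_upwards [(memLp_id_mul (c • f)).1.coeFn_toLp,
          (memLp_id_mul f).1.coeFn_toLp, Lp.coeFn_smul c f,
          Lp.coeFn_smul c ((memLp_id_mul f).1.toLp _)] with x h1 h2 h4 h5
        rw [RingHom.id_apply, h1, h5, Pi.smul_apply, h2, h4, Pi.smul_apply, smul_eq_mul,
          smul_eq_mul, mul_left_comm] }
    L (fun f => by
      refine Lp.norm_le_mul_norm_of_ae_le_mul ?_
      filter_upwards [(memLp_id_mul f).1.coeFn_toLp, (memLp_id_mul f).2] with x h1 h2
      rw [LinearMap.coe_mk, AddHom.coe_mk, h1]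
      exact h2)

theorem coeFn_mulCoord (f : L2 L) :
    (fun x => x * f x) =ᵐ[volume.restrict (Ioo (0 : ℝ) L)] mulCoord L f :=
  (memLp_id_mul f).1.coeFn_toLp.symm

theorem norm_mulCoord_le (hL : 0 < L) (f : L2 L) : ‖mulCoord L f‖ ≤ L * ‖f‖ :=
  (ContinuousLinearMap.le_opNorm _ f).trans
    (mul_le_mul_of_nonneg_right (LinearMap.mkContinuous_norm_le _ hL.le _) (norm_nonneg f))

theorem inner_mulCoord_comm (f g : L2 L) :
    ⟪f, mulCoord L g⟫ = ⟪mulCoord L f, g⟫ := by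
  rw [inner_eq_integral ae_eq_rfl (coeFn_mulCoord g),
    inner_eq_integral (coeFn_mulCoord f) ae_eq_rfl]
  congr 1; ext x; ring

section Identities

variable {p q : L2 L} {P Q : ℕ → ℝ → ℝ}

theorem IsJetRep.inner_eq (hP : IsJetRep p P) (hQ : IsJetRep q Q) {i j : ℕ} (hi : i ≤ 5)
    (hj : j ≤ 5) : ⟪weakDeriv i p, weakDeriv j q⟫ = ∫ x in Ioo 0 L, P i x * Q j x :=
  inner_eq_integral (hP.ae_eq i hi) (hQ.ae_eq j hj)

theorem IsJetRep.integrable_mul (hP : IsJetRep p P) (hQ : IsJetRep q Q) {i j : ℕ} (hi : i ≤ 5)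
    (hj : j ≤ 5) : Integrable (fun x => P i x * Q j x) (volume.restrict (Ioo (0 : ℝ) L)) :=
  integrable_mul_of_ae_eq (hP.ae_eq i hi) (hQ.ae_eq j hj)

theorem IsJetRep.inner_mulCoord_eq (hP : IsJetRep p P) {j : ℕ} (hj : j ≤ 5) :
    ⟪mulCoord L p, weakDeriv j p⟫ = ∫ x in Ioo 0 L, x * P 0 x * P j x := by
  refine inner_eq_integral ?_ (hP.ae_eq j hj)
  filter_upwards [hP.ae_eq 0 (by norm_num), coeFn_mulCoord p] with x h1 h2
  rw [← h2, h1, weakDeriv_zero]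

theorem IsJetRep.integrable_coord_mul (hP : IsJetRep p P) {j : ℕ} (hj : j ≤ 5) :
    Integrable (fun x => x * P 0 x * P j x) (volume.restrict (Ioo (0 : ℝ) L)) := by
  refine integrable_mul_of_ae_eq (f := mulCoord L p) ?_ (hP.ae_eq j hj)
  filter_upwards [hP.ae_eq 0 (by norm_num), coeFn_mulCoord p] with x h1 h2
  rw [← h2, h1, weakDeriv_zero]

theorem IsJetRep.norm_sq_eq (hP : IsJetRep p P) {i : ℕ} (hi : i ≤ 5) :
    ‖weakDeriv i p‖ ^ 2 = ∫ x in Ioo 0 L, P i x * P i x := by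
  rw [← real_inner_self_eq_norm_sq, hP.inner_eq hP hi hi]

theorem hasACDeriv_coord : HasACDeriv L (fun x => x) (fun _ => 1) := by
  simpa using HasACDeriv.of_contDiff (L := L) (F := fun x => x) contDiff_id

/-- The operator `∂ₓ` is skew on functions vanishing at the end points. -/
theorem IsJetRep.inner_deriv_one (hL : 0 < L) (hP : IsJetRep p P) (hQ : IsJetRep q Q) :
    ⟪weakDeriv 1 p, q⟫ + ⟪weakDeriv 1 q, p⟫ = 0 := by
  have h := ((hP.hasACDeriv 0 (by norm_num)).mul (hQ.hasACDeriv 0 (by norm_num))).integral_eq hL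
  rw [integral_add (hP.integrable_mul hQ (by norm_num) (by norm_num))
    (hP.integrable_mul hQ (by norm_num) (by norm_num)),
    ← hP.inner_eq hQ (by norm_num) (by norm_num), ← hP.inner_eq hQ (by norm_num) (by norm_num),
    hP.zero_left, hP.zero_right, weakDeriv_zero, weakDeriv_zero,
    real_inner_comm (weakDeriv (0 + 1) q) p] at h
  simpa using h

/-- The operator `∂ₓ³` is skew on `H⁵ ∩ H²₀`. -/
theorem IsJetRep.inner_deriv_three (hL : 0 < L) (hP : IsJetRep p P) (hQ : IsJetRep q Q) :
    ⟪weakDeriv 3 p, q⟫ + ⟪weakDeriv 3 q, p⟫ = 0 := by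
  have p0 := hP.hasACDeriv 0 (by norm_num)
  have p1 := hP.hasACDeriv 1 (by norm_num)
  have p2 := hP.hasACDeriv 2 (by norm_num)
  have q0 := hQ.hasACDeriv 0 (by norm_num)
  have q1 := hQ.hasACDeriv 1 (by norm_num)
  have q2 := hQ.hasACDeriv 2 (by norm_num)
  have h := (((p0.mul q2).add (p2.mul q0)).sub (p1.mul q1)).integral_eq hL
  have e1 := hP.inner_eq hQ (i := 3) (j := 0) (by norm_num) (by norm_num)
  have e2 := hQ.inner_eq hP (i := 3) (j := 0) (by norm_num) (by norm_num)
  rw [weakDeriv_zero] at e1 e2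
  rw [e1, e2, ← integral_add (hP.integrable_mul hQ (by norm_num) (by norm_num))
    (hQ.integrable_mul hP (by norm_num) (by norm_num))]
  simp only [hP.zero_left, hP.zero_right, hP.one_left, hP.one_right, hQ.zero_left,
    hQ.zero_right] at h
  refine Eq.trans (integral_congr_ae (Eventually.of_forall fun x => ?_)) (h.trans (by ring))
  norm_num
  ring

/-- The operator `∂ₓ⁵` is skew on `H⁵ ∩ H²₀` up to boundary values of second derivatives. -/
theorem IsJetRep.inner_deriv_five (hL : 0 < L) (hP : IsJetRep p P) (hQ : IsJetRep q Q) :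
    ⟪weakDeriv 5 p, q⟫ + ⟪weakDeriv 5 q, p⟫
      = pointValue (weakDeriv 2 p) L * pointValue (weakDeriv 2 q) L
        - pointValue (weakDeriv 2 p) 0 * pointValue (weakDeriv 2 q) 0 := by
  have p0 := hP.hasACDeriv 0 (by norm_num)
  have p1 := hP.hasACDeriv 1 (by norm_num)
  have p2 := hP.hasACDeriv 2 (by norm_num)
  have p3 := hP.hasACDeriv 3 (by norm_num)
  have p4 := hP.hasACDeriv 4 (by norm_num)
  have q0 := hQ.hasACDeriv 0 (by norm_num)
  have q1 := hQ.hasACDeriv 1 (by norm_num)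
  have q2 := hQ.hasACDeriv 2 (by norm_num)
  have q3 := hQ.hasACDeriv 3 (by norm_num)
  have q4 := hQ.hasACDeriv 4 (by norm_num)
  -- The primitive of `p₅ q + p q₅` is `p q₄ + p₄ q - p₁ q₃ - p₃ q₁ + p₂ q₂`; only the last term
  -- survives at the end points.
  have h := (((((p0.mul q4).add (p4.mul q0)).sub (p1.mul q3)).sub (p3.mul q1)).add
    (p2.mul q2)).integral_eq hL
  have e1 := hP.inner_eq hQ (i := 5) (j := 0) (by norm_num) (by norm_num)
  have e2 := hQ.inner_eq hP (i := 5) (j := 0) (by norm_num) (by norm_num)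
  rw [weakDeriv_zero] at e1 e2
  rw [e1, e2, ← integral_add (hP.integrable_mul hQ (by norm_num) (by norm_num))
    (hQ.integrable_mul hP (by norm_num) (by norm_num)), ← hP.two_left, ← hP.two_right,
    ← hQ.two_left, ← hQ.two_right]
  simp only [hP.zero_left, hP.zero_right, hP.one_left, hP.one_right, hQ.zero_left,
    hQ.zero_right, hQ.one_left, hQ.one_right] at h
  refine Eq.trans (integral_congr_ae (Eventually.of_forall fun x => ?_)) (h.trans (by ring))
  norm_num
  ring

theorem IsJetRep.inner_mulCoord_one (hL : 0 < L) (hP : IsJetRep p P) :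
    ⟪mulCoord L p, weakDeriv 1 p⟫ = -(1 / 2) * ‖p‖ ^ 2 := by
  have p0 := hP.hasACDeriv 0 (by norm_num)
  have h := ((hasACDeriv_coord.mul (p0.mul p0)).const_mul (1 / 2)).integral_eq hL
  have e0 := hP.norm_sq_eq (i := 0) (by norm_num)
  rw [weakDeriv_zero] at e0
  have e1 := hP.inner_mulCoord_eq (j := 1) (by norm_num)
  have i0 := hP.integrable_mul hP (i := 0) (j := 0) (by norm_num) (by norm_num)
  have i1 := hP.integrable_coord_mul (j := 1) (by norm_num)
  have hs : ⟪mulCoord L p, weakDeriv 1 p⟫ + 1 / 2 * ‖p‖ ^ 2 = 0 := by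
    rw [e0, e1, ← integral_const_mul, ← integral_add i1 (i0.const_mul _)]
    simp only [hP.zero_left, hP.zero_right] at h
    refine Eq.trans (integral_congr_ae (Eventually.of_forall fun x => ?_)) (h.trans (by ring))
    norm_num
    ring
  linarith

theorem IsJetRep.inner_mulCoord_three (hL : 0 < L) (hP : IsJetRep p P) :
    ⟪mulCoord L p, weakDeriv 3 p⟫ = 3 / 2 * ‖weakDeriv 1 p‖ ^ 2 := by
  have p0 := hP.hasACDeriv 0 (by norm_num)
  have p1 := hP.hasACDeriv 1 (by norm_num)
  have p2 := hP.hasACDeriv 2 (by norm_num)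
  -- The primitive of `x p p₃ - (3/2) p₁²` is `x p p₂ - p p₁ - x p₁² / 2`.
  have h := (((hasACDeriv_coord.mul (p0.mul p2)).sub (p0.mul p1)).sub
    ((hasACDeriv_coord.mul (p1.mul p1)).const_mul (1 / 2))).integral_eq hL
  have e0 := hP.norm_sq_eq (i := 1) (by norm_num)
  have e1 := hP.inner_mulCoord_eq (j := 3) (by norm_num)
  have i0 := hP.integrable_mul hP (i := 1) (j := 1) (by norm_num) (by norm_num)
  have i1 := hP.integrable_coord_mul (j := 3) (by norm_num)
  have hs : ⟪mulCoord L p, weakDeriv 3 p⟫ - 3 / 2 * ‖weakDeriv 1 p‖ ^ 2 = 0 := by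
    rw [e0, e1, ← integral_const_mul, ← integral_sub i1 (i0.const_mul _)]
    simp only [hP.zero_left, hP.zero_right, hP.one_left, hP.one_right] at h
    refine Eq.trans (integral_congr_ae (Eventually.of_forall fun x => ?_)) (h.trans (by ring))
    norm_num
    ring
  linarith

theorem IsJetRep.inner_mulCoord_five (hL : 0 < L) (hP : IsJetRep p P) :
    ⟪mulCoord L p, weakDeriv 5 p⟫
      = L / 2 * pointValue (weakDeriv 2 p) L ^ 2 - 5 / 2 * ‖weakDeriv 2 p‖ ^ 2 := by
  have p0 := hP.hasACDeriv 0 (by norm_num)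
  have p1 := hP.hasACDeriv 1 (by norm_num)
  have p2 := hP.hasACDeriv 2 (by norm_num)
  have p3 := hP.hasACDeriv 3 (by norm_num)
  have p4 := hP.hasACDeriv 4 (by norm_num)
  -- The primitive of `x p p₅ + (5/2) p₂²` is `x p p₄ - p p₃ - x p₁ p₃ + 2 p₁ p₂ + x p₂² / 2`; only
  -- the last term survives, at the end point `L`.
  have h := (((((hasACDeriv_coord.mul (p0.mul p4)).sub (p0.mul p3)).sub
    (hasACDeriv_coord.mul (p1.mul p3))).add ((p1.mul p2).const_mul 2)).add
    ((hasACDeriv_coord.mul (p2.mul p2)).const_mul (1 / 2))).integral_eq hL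
  have e0 := hP.norm_sq_eq (i := 2) (by norm_num)
  have e1 := hP.inner_mulCoord_eq (j := 5) (by norm_num)
  have i0 := hP.integrable_mul hP (i := 2) (j := 2) (by norm_num) (by norm_num)
  have i1 := hP.integrable_coord_mul (j := 5) (by norm_num)
  have hs : ⟪mulCoord L p, weakDeriv 5 p⟫ + 5 / 2 * ‖weakDeriv 2 p‖ ^ 2
      = L / 2 * pointValue (weakDeriv 2 p) L ^ 2 := by
    rw [e0, e1, ← integral_const_mul, ← integral_add i1 (i0.const_mul _), ← hP.two_right]
    simp only [hP.zero_left, hP.zero_right, hP.one_left, hP.one_right] at h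
    refine Eq.trans (integral_congr_ae (Eventually.of_forall fun x => ?_)) (h.trans (by ring))
    norm_num
    ring
  linarith

end Identities

/-! ### The operator on its domain -/

section Operator

variable {a b α₁ α₂ : ℝ}

/-- The domain `D(A)` as a subspace of `X₀`. -/
def domain (hL : 0 < L) (α₁ α₂ : ℝ) : Submodule ℝ (X0 L) where
  carrier := {y | MemDomain α₁ α₂ y}
  zero_mem' := by
    have hz : ∀ x ∈ Icc 0 L, pointValue (weakDeriv 2 (0 : L2 L)) x = 0 := by
      intro x hx
      have h := (memSobolev_zero 5).pointValue_smul (L := L) hL 0 (k := 2) (by norm_num) hx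
      rwa [smul_zero, zero_mul] at h
    have m0 : (0 : ℝ) ∈ Icc 0 L := by simp [hL.le]
    have m1 : L ∈ Icc 0 L := by simp [hL.le]
    exact ⟨memH20_zero hL, memH20_zero hL, memSobolev_zero 5, memSobolev_zero 5,
      by simp [hz 0 m0], by simp [hz L m1]⟩
  add_mem' := by
    rintro y z hy hz
    have m0 : (0 : ℝ) ∈ Icc 0 L := by simp [hL.le]
    have m1 : L ∈ Icc 0 L := by simp [hL.le]
    refine ⟨hy.memH20_fst.add hL hz.memH20_fst, hy.memH20_snd.add hL hz.memH20_snd,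
      hy.memSobolev_fst.add hz.memSobolev_fst, hy.memSobolev_snd.add hz.memSobolev_snd, ?_, ?_⟩
    · rw [WithLp.add_snd, WithLp.add_fst,
        hy.memSobolev_fst.pointValue_add hL hz.memSobolev_fst (by norm_num) m0,
        hy.memSobolev_snd.pointValue_add hL hz.memSobolev_snd (by norm_num) m0]
      linarith [hy.feedback_left, hz.feedback_left]
    · rw [WithLp.add_snd, WithLp.add_fst,
        hy.memSobolev_fst.pointValue_add hL hz.memSobolev_fst (by norm_num) m1,
        hy.memSobolev_snd.pointValue_add hL hz.memSobolev_snd (by norm_num) m1]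
      linarith [hy.feedback_right, hz.feedback_right]
  smul_mem' := by
    rintro c y hy
    have m0 : (0 : ℝ) ∈ Icc 0 L := by simp [hL.le]
    have m1 : L ∈ Icc 0 L := by simp [hL.le]
    refine ⟨hy.memH20_fst.smul hL c, hy.memH20_snd.smul hL c,
      hy.memSobolev_fst.smul c, hy.memSobolev_snd.smul c, ?_, ?_⟩
    · rw [WithLp.smul_snd, WithLp.smul_fst,
        hy.memSobolev_fst.pointValue_smul hL c (by norm_num) m0,
        hy.memSobolev_snd.pointValue_smul hL c (by norm_num) m0]
      linear_combination c * hy.feedback_left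
    · rw [WithLp.smul_snd, WithLp.smul_fst,
        hy.memSobolev_fst.pointValue_smul hL c (by norm_num) m1,
        hy.memSobolev_snd.pointValue_smul hL c (by norm_num) m1]
      linear_combination c * hy.feedback_right

/-- The operator `A` as a linear map on `D(A)`. -/
noncomputable def generator (hL : 0 < L) (a b α₁ α₂ : ℝ) : domain hL α₁ α₂ →ₗ[ℝ] X0 L where
  toFun y := opA a b y
  map_add' := by
    rintro ⟨y, hy⟩ ⟨z, hz⟩
    have hf := fun k (hk : k ≤ 5) => hy.memSobolev_fst.weakDeriv_add hz.memSobolev_fst hk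
    have hs := fun k (hk : k ≤ 5) => hy.memSobolev_snd.weakDeriv_add hz.memSobolev_snd hk
    simp only [opA, Submodule.coe_add, WithLp.add_fst, WithLp.add_snd, ← WithLp.toLp_add,
      hf 1 (by norm_num), hf 3 (by norm_num), hf 5 le_rfl, hs 1 (by norm_num), hs 3 (by norm_num),
      hs 5 le_rfl, Prod.mk_add_mk]
    congr 2 <;> module
  map_smul' := by
    rintro c ⟨y, hy⟩
    have hf := fun k (hk : k ≤ 5) => hy.memSobolev_fst.weakDeriv_smul c hk
    have hs := fun k (hk : k ≤ 5) => hy.memSobolev_snd.weakDeriv_smul c hk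
    simp only [opA, Submodule.coe_smul, WithLp.smul_fst, WithLp.smul_snd, ← WithLp.toLp_smul,
      hf 1 (by norm_num), hf 3 (by norm_num), hf 5 le_rfl, hs 1 (by norm_num), hs 3 (by norm_num),
      hs 5 le_rfl, Prod.smul_mk, RingHom.id_apply]
    congr 2 <;> module

/-- The boundary value `ηₓₓ(x)` as a linear functional on `D(A)`. -/
noncomputable def boundaryTrace (hL : 0 < L) (α₁ α₂ : ℝ) {x : ℝ} (hx : x ∈ Icc 0 L) :
    domain hL α₁ α₂ →ₗ[ℝ] ℝ where
  toFun y := pointValue (weakDeriv 2 (y : X0 L).fst) x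
  map_add' := by
    rintro ⟨y, hy⟩ ⟨z, hz⟩
    exact hy.memSobolev_fst.pointValue_add hL hz.memSobolev_fst (by norm_num) hx
  map_smul' := by
    rintro c ⟨y, hy⟩
    exact hy.memSobolev_fst.pointValue_smul hL c (by norm_num) hx

/-- The `2`-jet as a linear map on `D(A)`. -/
noncomputable def jetMap (hL : 0 < L) (α₁ α₂ : ℝ) :
    domain hL α₁ α₂ →ₗ[ℝ] PiLp 2 (fun _ : Fin 3 => X0 L) where
  toFun y := jet2 (y : X0 L)
  map_add' := by
    rintro ⟨y, hy⟩ ⟨z, hz⟩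
    ext1 k
    have hk : (k : ℕ) ≤ 5 := by omega
    simp only [jet2, Submodule.coe_add, WithLp.add_fst, WithLp.add_snd,
      hy.memSobolev_fst.weakDeriv_add hz.memSobolev_fst hk,
      hy.memSobolev_snd.weakDeriv_add hz.memSobolev_snd hk, ← WithLp.toLp_add, Pi.add_apply,
      Prod.mk_add_mk]
  map_smul' := by
    rintro c ⟨y, hy⟩
    ext1 k
    have hk : (k : ℕ) ≤ 5 := by omega
    simp only [jet2, Submodule.coe_smul, WithLp.smul_fst, WithLp.smul_snd,
      hy.memSobolev_fst.weakDeriv_smul c hk, hy.memSobolev_snd.weakDeriv_smul c hk,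
      ← WithLp.toLp_smul, Pi.smul_apply, Prod.smul_mk, RingHom.id_apply]

theorem inner_toLp_left (f g : L2 L) (z : X0 L) :
    ⟪(WithLp.toLp 2 (f, g) : X0 L), z⟫ = ⟪f, z.fst⟫ + ⟪g, z.snd⟫ :=
  WithLp.prod_inner_apply _ z

theorem inner_toLp_toLp (f g f' g' : L2 L) :
    ⟪(WithLp.toLp 2 (f, g) : X0 L), WithLp.toLp 2 (f', g')⟫ = ⟪f, f'⟫ + ⟪g, g'⟫ :=
  WithLp.prod_inner_apply _ _

theorem norm_toLp_sq (f g : L2 L) :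
    ‖(WithLp.toLp 2 (f, g) : X0 L)‖ ^ 2 = ‖f‖ ^ 2 + ‖g‖ ^ 2 :=
  WithLp.prod_norm_sq_eq_of_L2 _

/-- The symmetric multiplier `(η, u) ↦ (x u, x η)` on `X₀`. -/
noncomputable def multiplier (hL : 0 < L) : X0 L →L[ℝ] X0 L :=
  LinearMap.mkContinuous
    { toFun := fun y => WithLp.toLp 2 (mulCoord L y.snd, mulCoord L y.fst)
      map_add' := fun y z => by
        rw [WithLp.add_fst, WithLp.add_snd, map_add, map_add, ← WithLp.toLp_add, Prod.mk_add_mk]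
      map_smul' := fun c y => by
        rw [WithLp.smul_fst, WithLp.smul_snd, map_smul, map_smul, ← WithLp.toLp_smul,
          Prod.smul_mk, RingHom.id_apply] }
    L (fun y => by
      refine le_of_sq_le_sq ?_ (by positivity)
      have h1 := pow_le_pow_left₀ (norm_nonneg _) (norm_mulCoord_le hL y.fst) 2
      have h2 := pow_le_pow_left₀ (norm_nonneg _) (norm_mulCoord_le hL y.snd) 2
      rw [mul_pow] at h1 h2
      rw [LinearMap.coe_mk, AddHom.coe_mk, norm_toLp_sq, mul_pow, WithLp.prod_norm_sq_eq_of_L2]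
      linarith)

theorem multiplier_apply (hL : 0 < L) (y : X0 L) :
    multiplier hL y = WithLp.toLp 2 (mulCoord L y.snd, mulCoord L y.fst) := rfl

theorem inner_multiplier_comm (hL : 0 < L) (y z : X0 L) :
    ⟪y, multiplier hL z⟫ = ⟪multiplier hL y, z⟫ := by
  rw [multiplier_apply, multiplier_apply, real_inner_comm, inner_toLp_left, inner_toLp_left]
  have h1 := inner_mulCoord_comm y.fst z.snd
  have h2 := inner_mulCoord_comm y.snd z.fst
  rw [real_inner_comm] at h1 h2
  linarith

theorem norm_jet2_sq (y : X0 L) : ‖jet2 y‖ ^ 2 = ‖y‖ ^ 2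
    + (‖weakDeriv 1 y.fst‖ ^ 2 + ‖weakDeriv 1 y.snd‖ ^ 2)
    + (‖weakDeriv 2 y.fst‖ ^ 2 + ‖weakDeriv 2 y.snd‖ ^ 2) := by
  rw [PiLp.norm_sq_eq_of_L2, Fin.sum_univ_three]
  simp only [jet2, WithLp.prod_norm_sq_eq_of_L2]
  simp [weakDeriv_zero]

/-- The dissipation identity: the feedback turns the boundary terms of `∂ₓ⁵` into damping. -/
theorem inner_generator_self (hL : 0 < L) (y : domain hL α₁ α₂) :
    ⟪generator hL a b α₁ α₂ y, (y : X0 L)⟫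
      = -(α₂ * b * pointValue (weakDeriv 2 (y : X0 L).fst) L ^ 2
        + α₁ * b * pointValue (weakDeriv 2 (y : X0 L).fst) 0 ^ 2) := by
  obtain ⟨y, hy⟩ := y
  obtain ⟨P, hP⟩ := exists_isJetRep hL hy.memSobolev_fst hy.memH20_fst
  obtain ⟨Q, hQ⟩ := exists_isJetRep hL hy.memSobolev_snd hy.memH20_snd
  have e1 := hP.inner_deriv_one hL hQ
  have e3 := hP.inner_deriv_three hL hQ
  have e5 := hP.inner_deriv_five hL hQ
  have f0 := hy.feedback_left
  have f1 := hy.feedback_right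
  change ⟪opA a b y, y⟫ = _
  rw [opA, inner_toLp_left]
  simp only [inner_add_left, inner_sub_left, inner_neg_left, real_inner_smul_left]
  rw [eq_neg_of_add_eq_zero_left f0, eq_of_sub_eq_zero f1] at e5
  linear_combination -e1 + a * e3 - b * e5

/-- The Kato smoothing identity: pairing `A y` with the multiplier `x` produces the norm of
`H²(0,L)`, up to a boundary term at `L` that the dissipation controls. -/
theorem inner_generator_multiplier (hL : 0 < L) (y : domain hL α₁ α₂) :
    ⟪generator hL a b α₁ α₂ y, multiplier hL (y : X0 L)⟫
      = 1 / 2 * ‖(y : X0 L)‖ ^ 2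
        + 3 * a / 2 * (‖weakDeriv 1 (y : X0 L).fst‖ ^ 2 + ‖weakDeriv 1 (y : X0 L).snd‖ ^ 2)
        + 5 * b / 2 * (‖weakDeriv 2 (y : X0 L).fst‖ ^ 2 + ‖weakDeriv 2 (y : X0 L).snd‖ ^ 2)
        - b * L / 2 * (1 + α₂ ^ 2) * pointValue (weakDeriv 2 (y : X0 L).fst) L ^ 2 := by
  obtain ⟨y, hy⟩ := y
  obtain ⟨P, hP⟩ := exists_isJetRep hL hy.memSobolev_fst hy.memH20_fst
  obtain ⟨Q, hQ⟩ := exists_isJetRep hL hy.memSobolev_snd hy.memH20_snd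
  have p1 := hP.inner_mulCoord_one hL
  have p3 := hP.inner_mulCoord_three hL
  have p5 := hP.inner_mulCoord_five hL
  have q1 := hQ.inner_mulCoord_one hL
  have q3 := hQ.inner_mulCoord_three hL
  have q5 := hQ.inner_mulCoord_five hL
  change ⟪opA a b y, multiplier hL y⟫ = _
  rw [real_inner_comm, opA, multiplier_apply, inner_toLp_toLp, WithLp.prod_norm_sq_eq_of_L2]
  simp only [inner_add_right, inner_sub_right, inner_neg_right, real_inner_smul_right]
  rw [eq_of_sub_eq_zero hy.feedback_right] at q5
  linear_combination -p1 + a * p3 - b * p5 - q1 + a * q3 - b * q5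

end Operator

/-! ### Quadratic estimates for abstract evolution equations -/

section TimeIntegrals

variable {K : Type*} [NormedAddCommGroup K]

/-- A bound on the `L²` norms over bounded time intervals gives one over `(0,∞)`. -/
theorem memLp_Ioi_of_integral_le {f : ℝ → K} (hf : ContinuousOn f (Ici 0)) {B : ℝ}
    (hB : ∀ T, 0 < T → ∫ t in (0 : ℝ)..T, ‖f t‖ ^ 2 ≤ B) :
    MemLp f 2 (volume.restrict (Ioi 0)) ∧ ∫ t in Ioi 0, ‖f t‖ ^ 2 ≤ B := by
  have hc : ContinuousOn (fun t => ‖f t‖ ^ 2) (Ici 0) := hf.norm.pow 2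
  have hi : IntegrableOn (fun t => ‖f t‖ ^ 2) (Ioi 0) := by
    refine integrableOn_Ioi_of_intervalIntegral_norm_bounded (l := atTop) (b := fun T : ℝ => T)
      B 0 (fun T => ?_) tendsto_id ?_
    · exact ((hc.mono Icc_subset_Ici_self).integrableOn_Icc).mono_set Ioc_subset_Icc_self
    · filter_upwards [eventually_gt_atTop 0] with T hT
      simpa using hB T hT
  refine ⟨(memLp_two_iff_integrable_sq_norm
    ((hf.mono Ioi_subset_Ici_self).aestronglyMeasurable measurableSet_Ioi)).2 hi, ?_⟩
  refine le_of_tendsto (intervalIntegral_tendsto_integral_Ioi 0 hi tendsto_id) ?_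
  filter_upwards [eventually_gt_atTop 0] with T hT using hB T hT

theorem tendsto_eLpNorm_sub {μ : Measure ℝ} {f : ℕ → ℝ → K} {hf : ∀ n, MemLp (f n) 2 μ}
    {Z : Lp K 2 μ} (hZ : Tendsto (fun n => (hf n).toLp (f n)) atTop (𝓝 Z)) :
    Tendsto (fun n => eLpNorm (f n - (Z : ℝ → K)) 2 μ) atTop (𝓝 0) := by
  refine (Lp.tendsto_Lp_iff_tendsto_eLpNorm'' f hf Z (Lp.memLp Z)).1 ?_
  rwa [Lp.toLp_coeFn Z (Lp.memLp Z)]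

theorem tendsto_eLpNorm_sub_Ioc {f : ℕ → ℝ → K}
    {hf : ∀ n, MemLp (f n) 2 (volume.restrict (Ioi 0))}
    {Z : Lp K 2 (volume.restrict (Ioi (0 : ℝ)))}
    (hZ : Tendsto (fun n => (hf n).toLp (f n)) atTop (𝓝 Z)) (T : ℝ) :
    Tendsto (fun n => eLpNorm (f n - (Z : ℝ → K)) 2 (volume.restrict (Ioc 0 T))) atTop (𝓝 0) :=
  tendsto_of_tendsto_of_tendsto_of_le_of_le tendsto_const_nhds (tendsto_eLpNorm_sub hZ)
    (fun _ => zero_le) fun _ =>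
      eLpNorm_mono_measure _ (Measure.restrict_mono Ioc_subset_Ioi_self le_rfl)

theorem memLp_Ioc_of_memLp_Ioi {f : ℝ → K} (hf : MemLp f 2 (volume.restrict (Ioi (0 : ℝ)))) (T : ℝ) :
    MemLp f 2 (volume.restrict (Ioc 0 T)) :=
  hf.mono_measure (Measure.restrict_mono Ioc_subset_Ioi_self le_rfl)

theorem tendsto_intervalIntegral_of_tendsto_toLp [NormedSpace ℝ K] {f : ℕ → ℝ → K}
    {hf : ∀ n, MemLp (f n) 2 (volume.restrict (Ioi 0))}
    {Z : Lp K 2 (volume.restrict (Ioi (0 : ℝ)))}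
    (hZ : Tendsto (fun n => (hf n).toLp (f n)) atTop (𝓝 Z)) {T : ℝ} (hT : 0 ≤ T) :
    Tendsto (fun n => ∫ t in (0 : ℝ)..T, f n t) atTop (𝓝 (∫ t in (0 : ℝ)..T, Z t)) := by
  simp only [intervalIntegral.integral_of_le hT]
  have hZm := memLp_Ioc_of_memLp_Ioi (Lp.memLp Z) T
  refine tendsto_integral_of_L1' _ (hZm.aestronglyMeasurable)
    (Eventually.of_forall fun n => (memLp_Ioc_of_memLp_Ioi (hf n) T).integrable one_le_two) ?_
  have h := ENNReal.Tendsto.mul_const (tendsto_eLpNorm_sub_Ioc hZ T)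
    (b := (volume.restrict (Ioc 0 T)) univ ^ (1 / (1 : ℝ≥0∞).toReal - 1 / (2 : ℝ≥0∞).toReal))
    (Or.inr (by
      refine ENNReal.rpow_ne_top_of_nonneg (by norm_num) (by simp)))
  rw [zero_mul] at h
  exact tendsto_of_tendsto_of_tendsto_of_le_of_le tendsto_const_nhds h (fun _ => zero_le)
    fun n => eLpNorm_le_eLpNorm_mul_rpow_measure_univ one_le_two
      (((memLp_Ioc_of_memLp_Ioi (hf n) T).sub hZm).aestronglyMeasurable)

end TimeIntegrals

section Evolution

variable {H K : Type*} [NormedAddCommGroup H] [InnerProductSpace ℝ H]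
  [NormedAddCommGroup K] [InnerProductSpace ℝ K]
  {D : Submodule ℝ H} {A : D →ₗ[ℝ] H}

/-- A strict solution of `dw/dt = A w` on `[0,∞)`: continuously differentiable in `H`, with values
in the domain `D` of `A`. -/
structure IsStrictSolution (A : D →ₗ[ℝ] H) (w : ℝ → D) : Prop where
  continuousOn : ContinuousOn (fun t => (w t : H)) (Ici 0)
  continuousOn_apply : ContinuousOn (fun t => A (w t)) (Ici 0)
  hasDerivAt : ∀ t, 0 < t → HasDerivAt (fun t => (w t : H)) (A (w t)) t

theorem IsStrictSolution.sub {v w : ℝ → D} (hv : IsStrictSolution A v)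
    (hw : IsStrictSolution A w) : IsStrictSolution A (fun t => v t - w t) := by
  refine ⟨hv.continuousOn.sub hw.continuousOn, ?_, fun t ht => ?_⟩
  · simp only [map_sub]
    exact hv.continuousOn_apply.sub hw.continuousOn_apply
  · rw [map_sub]
    exact (hv.hasDerivAt t ht).sub (hw.hasDerivAt t ht)

/-- The balance law of the quadratic form of a symmetric operator along a strict solution. -/
theorem IsStrictSolution.integral_inner {w : ℝ → D} (hw : IsStrictSolution A w) (S : H →L[ℝ] H)
    (hS : ∀ x y, ⟪x, S y⟫ = ⟪S x, y⟫) {T : ℝ} (hT : 0 ≤ T) :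
    ∫ t in (0 : ℝ)..T, ⟪A (w t), S (w t)⟫
      = 1 / 2 * ⟪(w T : H), S (w T)⟫ - 1 / 2 * ⟪(w 0 : H), S (w 0)⟫ := by
  have hsub : Icc 0 T ⊆ Ici (0 : ℝ) := Icc_subset_Ici_self
  have hSw : ContinuousOn (fun t => S (w t)) (Ici 0) :=
    S.continuous.comp_continuousOn hw.continuousOn
  refine intervalIntegral.integral_eq_sub_of_hasDerivAt_of_le
    (f := fun t => 1 / 2 * ⟪(w t : H), S (w t)⟫) hT
    (continuousOn_const.mul ((hw.continuousOn.inner hSw).mono hsub)) (fun t ht => ?_) ?_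
  · have h1 := hw.hasDerivAt t ht.1
    have h2 := ((h1.inner ℝ (S.hasFDerivAt.comp_hasDerivAt t h1)).const_mul (1 / 2))
    convert! h2 using 1
    simp only [Function.comp_apply]
    rw [hS, real_inner_comm]
    ring
  · refine ContinuousOn.intervalIntegrable ?_
    rw [uIcc_of_le hT]
    exact (hw.continuousOn_apply.inner hSw).mono hsub

/-- A linear map on `D` that is bounded for the graph norm, in the multiplicative form
`‖N v‖² ≤ C ‖v‖ ‖A v‖`, is continuous along curves that are continuous for the graph norm. -/
theorem continuousOn_apply_of_sq_le {N : D →ₗ[ℝ] K} {C : ℝ}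
    (hN : ∀ v : D, ‖N v‖ ^ 2 ≤ C * (‖(v : H)‖ * ‖A v‖)) {w : ℝ → D} {s : Set ℝ}
    (hw : ContinuousOn (fun t => (w t : H)) s) (hAw : ContinuousOn (fun t => A (w t)) s) :
    ContinuousOn (fun t => N (w t)) s := by
  intro t ht
  have h1 : Tendsto (fun r => C * (‖(w r : H) - w t‖ * ‖A (w r) - A (w t)‖)) (𝓝[s] t) (𝓝 0) := by
    have e1 := tendsto_iff_norm_sub_tendsto_zero.1 (hw t ht)
    have e2 := tendsto_iff_norm_sub_tendsto_zero.1 (hAw t ht)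
    simpa using (e1.mul e2).const_mul C
  have h2 : Tendsto (fun r => ‖N (w r) - N (w t)‖ ^ 2) (𝓝[s] t) (𝓝 0) := by
    refine squeeze_zero (fun _ => by positivity) (fun r => ?_) h1
    simpa only [map_sub, Submodule.coe_sub] using hN (w r - w t)
  refine tendsto_iff_norm_sub_tendsto_zero.2 ?_
  simpa using h2.sqrt

theorem norm_toLp_sq_eq_integral {μ : Measure ℝ} {f : ℝ → K} (hf : MemLp f 2 μ) :
    ‖hf.toLp f‖ ^ 2 = ∫ t, ‖f t‖ ^ 2 ∂μ := by
  rw [← real_inner_self_eq_norm_sq, L2.inner_def]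
  refine integral_congr_ae ?_
  filter_upwards [hf.coeFn_toLp] with t ht
  rw [ht, real_inner_self_eq_norm_sq]

theorem tendsto_integral_norm_sq {f : ℕ → ℝ → K}
    {hf : ∀ n, MemLp (f n) 2 (volume.restrict (Ioi 0))}
    {Z : Lp K 2 (volume.restrict (Ioi (0 : ℝ)))}
    (hZ : Tendsto (fun n => (hf n).toLp (f n)) atTop (𝓝 Z)) {T : ℝ} (hT : 0 ≤ T) :
    Tendsto (fun n => ∫ t in (0 : ℝ)..T, ‖f n t‖ ^ 2) atTop
      (𝓝 (∫ t in (0 : ℝ)..T, ‖Z t‖ ^ 2)) := by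
  have h := (Lp.tendsto_Lp_iff_tendsto_eLpNorm'' f (fun n => memLp_Ioc_of_memLp_Ioi (hf n) T) Z
    (memLp_Ioc_of_memLp_Ioi (Lp.memLp Z) T)).2 (tendsto_eLpNorm_sub_Ioc hZ T)
  have h2 := h.norm.pow 2
  simp only [norm_toLp_sq_eq_integral] at h2
  simpa only [intervalIntegral.integral_of_le hT] using h2

/-- A graph norm bound from a quadratic one. -/
theorem sq_le_of_le_inner {N : D →ₗ[ℝ] K} {S : H →L[ℝ] H} {B : ℝ}
    (hSB : ∀ x, ‖S x‖ ≤ B * ‖x‖) (hN : ∀ v : D, ‖N v‖ ^ 2 ≤ ⟪A v, S v⟫) (v : D) :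
    ‖N v‖ ^ 2 ≤ B * (‖(v : H)‖ * ‖A v‖) := by
  refine (hN v).trans ((real_inner_le_norm _ _).trans ?_)
  refine (mul_le_mul_of_nonneg_left (hSB v) (norm_nonneg _)).trans (le_of_eq ?_)
  ring

theorem IsStrictSolution.norm_le {w : ℝ → D} (hw : IsStrictSolution A w)
    (hA : ∀ v : D, ⟪A v, (v : H)⟫ ≤ 0) {T : ℝ} (hT : 0 ≤ T) :
    ‖(w T : H)‖ ^ 2 ≤ ‖(w 0 : H)‖ ^ 2 := by
  have h1 := hw.integral_inner (ContinuousLinearMap.id ℝ H) (fun _ _ => rfl) hT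
  have h2 : 0 ≤ ∫ t in (0 : ℝ)..T, -⟪A (w t), (w t : H)⟫ :=
    intervalIntegral.integral_nonneg hT fun t _ => neg_nonneg.2 (hA _)
  rw [intervalIntegral.integral_neg] at h2
  simp only [ContinuousLinearMap.id_apply, real_inner_self_eq_norm_sq] at h1
  linarith

/-- If `A` is dissipative and `‖N v‖²` is at most `⟪A v, S v⟫` for a bounded symmetric `S`, then
the balance law for `S` bounds `N w` in `L²` in time along strict solutions `w`. -/
theorem IsStrictSolution.integral_norm_sq_le {w : ℝ → D} (hw : IsStrictSolution A w)
    (hA : ∀ v : D, ⟪A v, (v : H)⟫ ≤ 0) {N : D →ₗ[ℝ] K} {S : H →L[ℝ] H} {B : ℝ} (hB : 0 ≤ B)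
    (hS : ∀ x y, ⟪x, S y⟫ = ⟪S x, y⟫) (hSB : ∀ x, ‖S x‖ ≤ B * ‖x‖)
    (hN : ∀ v : D, ‖N v‖ ^ 2 ≤ ⟪A v, S v⟫) {T : ℝ} (hT : 0 ≤ T) :
    ∫ t in (0 : ℝ)..T, ‖N (w t)‖ ^ 2 ≤ B * ‖(w 0 : H)‖ ^ 2 := by
  have hsub : uIcc 0 T ⊆ Ici (0 : ℝ) := by
    rw [uIcc_of_le hT]
    exact Icc_subset_Ici_self
  have hc := continuousOn_apply_of_sq_le (sq_le_of_le_inner hSB hN) hw.continuousOn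
    hw.continuousOn_apply
  have h1 : ∫ t in (0 : ℝ)..T, ‖N (w t)‖ ^ 2 ≤ ∫ t in (0 : ℝ)..T, ⟪A (w t), S (w t)⟫ := by
    refine intervalIntegral.integral_mono_on hT ?_ ?_ fun t _ => hN (w t)
    · exact ((hc.norm.pow 2).mono hsub).intervalIntegrable
    · exact ((hw.continuousOn_apply.inner
        (S.continuous.comp_continuousOn hw.continuousOn)).mono hsub).intervalIntegrable
  rw [hw.integral_inner S hS hT] at h1
  have h2 : ∀ x : H, |⟪x, S x⟫| ≤ B * ‖x‖ ^ 2 := fun x => by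
    refine (abs_real_inner_le_norm _ _).trans ?_
    refine (mul_le_mul_of_nonneg_left (hSB x) (norm_nonneg _)).trans (le_of_eq ?_)
    ring
  have h3 := (abs_le.1 (h2 (w T))).2
  have h4 := (abs_le.1 (h2 (w 0))).1
  have h5 := mul_le_mul_of_nonneg_left (hw.norm_le hA hT) hB
  linarith

/-- A mild solution `y` of `dy/dt = A y`, `y(0) = y₀`, together with its primitive `Y`, which
takes its values in `D`. Only times `t ≥ 0` matter. -/
structure IsMildPair (A : D →ₗ[ℝ] H) (y₀ : H) (y : ℝ → H) (Y : ℝ → D) : Prop where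
  continuous : Continuous y
  coe_eq : ∀ t, 0 ≤ t → (Y t : H) = ∫ s in (0 : ℝ)..t, y s
  eq_add : ∀ t, 0 ≤ t → y t = y₀ + A (Y t)

/-- The difference quotient of `Y` with step `h`, that is the time average of `y` over
`[t, t + h]`. -/
noncomputable def diffQuot (Y : ℝ → D) (h t : ℝ) : D := h⁻¹ • (Y (t + h) - Y t)

/-- The steps `1 / (n + 1)`. -/
noncomputable def step (n : ℕ) : ℝ := 1 / ((n : ℝ) + 1)

theorem step_pos (n : ℕ) : 0 < step n := Nat.one_div_pos_of_nat

theorem tendsto_step : Tendsto step atTop (𝓝[≠] 0) :=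
  tendsto_nhdsWithin_iff.2 ⟨tendsto_one_div_add_atTop_nhds_zero_nat,
    Eventually.of_forall fun n => (step_pos n).ne'⟩

theorem hasDerivAt_primitive [CompleteSpace H] {y : ℝ → H} (hy : Continuous y) (t : ℝ) :
    HasDerivAt (fun t => ∫ s in (0 : ℝ)..t, y s) (y t) t :=
  intervalIntegral.integral_hasDerivAt_right (hy.intervalIntegrable _ _)
    (hy.stronglyMeasurableAtFilter _ _) hy.continuousAt

namespace IsMildPair

variable {y₀ : H} {y : ℝ → H} {Y : ℝ → D}

theorem coe_diffQuot (hy : IsMildPair A y₀ y Y) {h t : ℝ} (hh : 0 < h) (ht : 0 ≤ t) :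
    (diffQuot Y h t : H)
      = h⁻¹ • ((∫ s in (0 : ℝ)..(t + h), y s) - ∫ s in (0 : ℝ)..t, y s) := by
  rw [diffQuot, Submodule.coe_smul, Submodule.coe_sub, hy.coe_eq _ (by positivity),
    hy.coe_eq t ht]

theorem apply_diffQuot (hy : IsMildPair A y₀ y Y) {h t : ℝ} (hh : 0 < h) (ht : 0 ≤ t) :
    A (diffQuot Y h t) = h⁻¹ • (y (t + h) - y t) := by
  rw [diffQuot, map_smul, map_sub, hy.eq_add _ (by positivity : 0 ≤ t + h), hy.eq_add t ht,
    add_sub_add_left_eq_sub]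

theorem apply_zero (hy : IsMildPair A y₀ y Y) : Y 0 = 0 := by
  ext
  rw [hy.coe_eq 0 le_rfl]
  simp

theorem zero_eq (hy : IsMildPair A y₀ y Y) : y 0 = y₀ := by
  rw [hy.eq_add 0 le_rfl, hy.apply_zero, map_zero, add_zero]

/-- A subsequence of `N` of the time averages converges almost everywhere. -/
theorem exists_seq_tendsto_ae {N : D →ₗ[ℝ] K}
    {hv : ∀ n, MemLp (fun t => N (diffQuot Y (step n) t)) 2 (volume.restrict (Ioi 0))}
    {Z : Lp K 2 (volume.restrict (Ioi (0 : ℝ)))}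
    (hZ : Tendsto (fun n => (hv n).toLp _) atTop (𝓝 Z)) :
    ∃ ns : ℕ → ℕ, StrictMono ns ∧ ∀ᵐ t ∂(volume.restrict (Ioi (0 : ℝ))),
      Tendsto (fun i => N (diffQuot Y (step (ns i)) t)) atTop (𝓝 (Z t)) :=
  (tendstoInMeasure_of_tendsto_eLpNorm (by norm_num) (fun n => (hv n).aestronglyMeasurable)
    (Lp.aestronglyMeasurable Z) (tendsto_eLpNorm_sub hZ)).exists_seq_tendsto_ae

variable [CompleteSpace H]

/-- Time averages of a mild solution are strict solutions. -/
theorem isStrictSolution_diffQuot (hy : IsMildPair A y₀ y Y) {h : ℝ} (hh : 0 < h) :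
    IsStrictSolution A (diffQuot Y h) := by
  have hd := hasDerivAt_primitive hy.continuous
  have hI : Continuous (fun t => ∫ s in (0 : ℝ)..t, y s) :=
    continuous_iff_continuousAt.2 fun t => (hd t).continuousAt
  refine ⟨?_, ?_, fun t ht => ?_⟩
  · have hc : Continuous (fun t => h⁻¹ • ((∫ s in (0 : ℝ)..(t + h), y s)
        - ∫ s in (0 : ℝ)..t, y s)) :=
      ((hI.comp (continuous_id.add continuous_const)).sub hI).const_smul h⁻¹
    exact hc.continuousOn.congr fun t ht => hy.coe_diffQuot hh ht
  · have hc : Continuous (fun t => h⁻¹ • (y (t + h) - y t)) :=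
      ((hy.continuous.comp (continuous_id.add continuous_const)).sub hy.continuous).const_smul h⁻¹
    exact hc.continuousOn.congr fun t ht => hy.apply_diffQuot hh ht
  · rw [hy.apply_diffQuot hh ht.le]
    have h1 : HasDerivAt (fun t => h⁻¹ • ((∫ s in (0 : ℝ)..(t + h), y s)
        - ∫ s in (0 : ℝ)..t, y s)) (h⁻¹ • (y (t + h) - y t)) t :=
      (((hd (t + h)).comp_add_const t h).sub (hd t)).const_smul h⁻¹
    refine h1.congr_of_eventuallyEq ?_
    filter_upwards [eventually_gt_nhds ht] with r hr using hy.coe_diffQuot hh hr.le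

theorem tendsto_diffQuot (hy : IsMildPair A y₀ y Y) {t : ℝ} (ht : 0 ≤ t) :
    Tendsto (fun n => (diffQuot Y (step n) t : H)) atTop (𝓝 (y t)) := by
  have h := (hasDerivAt_iff_tendsto_slope_zero.1
    (hasDerivAt_primitive hy.continuous t)).comp tendsto_step
  refine h.congr fun n => ?_
  rw [Function.comp_apply, hy.coe_diffQuot (step_pos n) ht]

/-- Extension of an estimate from strict to mild solutions. If `A` is dissipative and `‖N v‖²` is
at most `⟪A v, S v⟫` for a bounded symmetric `S`, then `N` of the time averages of a mild solution
is a Cauchy sequence in `L²(0,∞)`, because differences of time averages are strict solutions. -/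
theorem exists_trace [CompleteSpace K] (hy : IsMildPair A y₀ y Y)
    (hA : ∀ v : D, ⟪A v, (v : H)⟫ ≤ 0) {N : D →ₗ[ℝ] K} {S : H →L[ℝ] H} {B : ℝ} (hB : 0 ≤ B)
    (hS : ∀ x y, ⟪x, S y⟫ = ⟪S x, y⟫) (hSB : ∀ x, ‖S x‖ ≤ B ^ 2 * ‖x‖)
    (hN : ∀ v : D, ‖N v‖ ^ 2 ≤ ⟪A v, S v⟫) :
    ∃ (hv : ∀ n, MemLp (fun t => N (diffQuot Y (step n) t)) 2 (volume.restrict (Ioi 0)))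
      (Z : Lp K 2 (volume.restrict (Ioi (0 : ℝ)))),
      Tendsto (fun n => (hv n).toLp _) atTop (𝓝 Z) ∧ ‖Z‖ ≤ B * ‖y₀‖ := by
  have hst := fun n => hy.isStrictSolution_diffQuot (step_pos n)
  have hb : ∀ w : ℝ → D, IsStrictSolution A w →
      ∃ hw : MemLp (fun t => N (w t)) 2 (volume.restrict (Ioi 0)),
        ‖hw.toLp _‖ ≤ B * ‖(w 0 : H)‖ := by
    intro w hw
    obtain ⟨h1, h2⟩ := memLp_Ioi_of_integral_le
      (continuousOn_apply_of_sq_le (sq_le_of_le_inner hSB hN) hw.continuousOn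
        hw.continuousOn_apply)
      fun T hT => hw.integral_norm_sq_le hA (sq_nonneg B) hS hSB hN hT.le
    refine ⟨h1, le_of_sq_le_sq ?_ (by positivity)⟩
    rw [norm_toLp_sq_eq_integral, mul_pow]
    exact h2
  choose hv hvn using fun n => hb _ (hst n)
  have h0 := hy.tendsto_diffQuot (t := 0) le_rfl
  rw [hy.zero_eq] at h0
  have hcau : CauchySeq (fun n => (hv n).toLp _) := by
    have h1 := Metric.cauchySeq_iff'.1 h0.cauchySeq
    rw [Metric.cauchySeq_iff']
    intro ε hε
    obtain ⟨n, hn⟩ := h1 (ε / (B + 1)) (by positivity)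
    refine ⟨n, fun m hm => ?_⟩
    obtain ⟨h2, h3⟩ := hb _ ((hst m).sub (hst n))
    have h4 : (hv m).toLp _ - (hv n).toLp _ = h2.toLp _ := by
      rw [← MemLp.toLp_sub]
      congr 1
      ext t
      simp
    have h5 := hn m hm
    rw [dist_eq_norm] at h5 ⊢
    rw [h4]
    refine h3.trans_lt ?_
    rw [Submodule.coe_sub]
    have h6 : B * ‖(diffQuot Y (step m) 0 : H) - diffQuot Y (step n) 0‖ ≤
        (B + 1) * ‖(diffQuot Y (step m) 0 : H) - diffQuot Y (step n) 0‖ :=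
      mul_le_mul_of_nonneg_right (by linarith) (norm_nonneg _)
    rw [lt_div_iff₀ (by positivity)] at h5
    linarith
  obtain ⟨Z, hZ⟩ := cauchySeq_tendsto_of_complete hcau
  exact ⟨hv, Z, hZ, le_of_tendsto_of_tendsto' hZ.norm (h0.norm.const_mul B) hvn⟩

/-- The limit of `N` of the time averages is the time derivative of `N Y`. -/
theorem integral_trace_eq [CompleteSpace K] (hy : IsMildPair A y₀ y Y) {N : D →ₗ[ℝ] K} {C : ℝ}
    (hN : ∀ v : D, ‖N v‖ ^ 2 ≤ C * (‖(v : H)‖ * ‖A v‖))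
    {hv : ∀ n, MemLp (fun t => N (diffQuot Y (step n) t)) 2 (volume.restrict (Ioi 0))}
    {Z : Lp K 2 (volume.restrict (Ioi (0 : ℝ)))}
    (hZ : Tendsto (fun n => (hv n).toLp _) atTop (𝓝 Z)) {t : ℝ} (ht : 0 ≤ t) :
    IntervalIntegrable Z volume 0 t ∧ N (Y t) = ∫ s in (0 : ℝ)..t, Z s := by
  refine ⟨(intervalIntegrable_iff_integrableOn_Ioc_of_le ht).2
    ((memLp_Ioc_of_memLp_Ioi (Lp.memLp Z) t).integrable one_le_two), ?_⟩
  -- `P` is `N Y`, extended to negative times by the constant `N (Y 0) = 0`.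
  set P : ℝ → K := fun s => N (Y (max s 0)) with hP
  have hI : Continuous (fun t => ∫ s in (0 : ℝ)..t, y s) :=
    continuous_iff_continuousAt.2 fun t => (hasDerivAt_primitive hy.continuous t).continuousAt
  have hPc : Continuous P := by
    have h1 : ContinuousOn (fun s => N (Y s)) (Ici 0) := by
      refine continuousOn_apply_of_sq_le hN (hI.continuousOn.congr fun s hs => hy.coe_eq s hs) ?_
      refine (hy.continuous.sub (continuous_const (y := y₀))).continuousOn.congr fun s hs => ?_
      exact (sub_eq_of_eq_add' (hy.eq_add s hs)).symm
    exact h1.comp_continuous (continuous_id.max continuous_const) 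
      fun s => mem_Ici.2 (le_max_right _ _)
  have hd := hasDerivAt_primitive hPc
  have hquot : ∀ n, ∫ s in (0 : ℝ)..t, N (diffQuot Y (step n) s)
      = (step n)⁻¹ • ((∫ s in (0 : ℝ)..(t + step n), P s) - ∫ s in (0 : ℝ)..t, P s)
        - (step n)⁻¹ • ((∫ s in (0 : ℝ)..(0 + step n), P s) - ∫ s in (0 : ℝ)..0, P s) := by
    intro n
    have h1 : ∫ s in (0 : ℝ)..t, N (diffQuot Y (step n) s)
        = ∫ s in (0 : ℝ)..t, (step n)⁻¹ • (P (s + step n) - P s) := by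
      refine intervalIntegral.integral_congr fun s hs => ?_
      rw [uIcc_of_le ht] at hs
      have h2 : 0 ≤ s + step n := add_nonneg hs.1 (step_pos n).le
      simp only [hP, diffQuot, map_smul, map_sub, max_eq_left hs.1, max_eq_left h2]
    have h3 : Continuous fun s => P (s + step n) := hPc.comp (continuous_id.add continuous_const)
    rw [h1, intervalIntegral.integral_smul, intervalIntegral.integral_sub
      (h3.intervalIntegrable _ _) (hPc.intervalIntegrable _ _),
      intervalIntegral.integral_comp_add_right (fun s => P s),
      ← intervalIntegral.integral_interval_sub_left (hPc.intervalIntegrable _ _)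
        (hPc.intervalIntegrable 0 (0 + step n)), intervalIntegral.integral_same, ← smul_sub]
    congr 1
    abel
  have h1 := ((hasDerivAt_iff_tendsto_slope_zero.1 (hd t)).comp tendsto_step).sub
    ((hasDerivAt_iff_tendsto_slope_zero.1 (hd 0)).comp tendsto_step)
  have h2 := tendsto_intervalIntegral_of_tendsto_toLp hZ ht
  have h3 := tendsto_nhds_unique (h1.congr fun n => (hquot n).symm) h2
  rw [← h3]
  simp [hP, max_eq_left ht, hy.apply_zero]

end IsMildPair

end Evolution

/-! ### Traces and smoothing for the damped system -/

section Estimates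

variable {a b α₁ α₂ : ℝ}

theorem inner_generator_self_nonpos (hL : 0 < L) (hb : 0 < b) (hα₁ : 0 < α₁) (hα₂ : 0 < α₂)
    (v : domain hL α₁ α₂) : ⟪generator hL a b α₁ α₂ v, (v : X0 L)⟫ ≤ 0 := by
  rw [inner_generator_self, neg_nonpos]
  positivity

theorem norm_boundaryTrace_left_sq_le (hL : 0 < L) (hb : 0 < b) (hα₁ : 0 < α₁) (hα₂ : 0 < α₂)
    (v : domain hL α₁ α₂) : ‖boundaryTrace hL α₁ α₂ (left_mem_Icc.2 hL.le) v‖ ^ 2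
      ≤ ⟪generator hL a b α₁ α₂ v, (-(α₁ * b)⁻¹ • ContinuousLinearMap.id ℝ (X0 L)) v⟫ := by
  change ‖pointValue (weakDeriv 2 (v : X0 L).fst) 0‖ ^ 2 ≤ _
  rw [smul_apply, ContinuousLinearMap.id_apply, real_inner_smul_right,
    inner_generator_self, Real.norm_eq_abs, sq_abs, neg_mul_neg, inv_mul_eq_div,
    le_div_iff₀ (by positivity)]
  have : 0 ≤ α₂ * b * pointValue (weakDeriv 2 (v : X0 L).fst) L ^ 2 := by positivity
  linarith

theorem norm_boundaryTrace_right_sq_le (hL : 0 < L) (hb : 0 < b) (hα₁ : 0 < α₁) (hα₂ : 0 < α₂)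
    (v : domain hL α₁ α₂) : ‖boundaryTrace hL α₁ α₂ (right_mem_Icc.2 hL.le) v‖ ^ 2
      ≤ ⟪generator hL a b α₁ α₂ v, (-(α₂ * b)⁻¹ • ContinuousLinearMap.id ℝ (X0 L)) v⟫ := by
  change ‖pointValue (weakDeriv 2 (v : X0 L).fst) L‖ ^ 2 ≤ _
  rw [smul_apply, ContinuousLinearMap.id_apply, real_inner_smul_right,
    inner_generator_self, Real.norm_eq_abs, sq_abs, neg_mul_neg, inv_mul_eq_div,
    le_div_iff₀ (by positivity)]
  have : 0 ≤ α₁ * b * pointValue (weakDeriv 2 (v : X0 L).fst) 0 ^ 2 := by positivity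
  linarith

/-- The symmetric operator whose balance law controls the norm of `H²(0,L)`: the multiplier `x`,
corrected by a multiple of the energy that absorbs the boundary term at `L`. -/
noncomputable def smoothingForm (hL : 0 < L) (a b α₂ : ℝ) : X0 L →L[ℝ] X0 L :=
  (min (1 / 2) (min (3 * a / 2) (5 * b / 2)))⁻¹ •
    (multiplier hL - (L * (1 + α₂ ^ 2) / (2 * α₂)) • ContinuousLinearMap.id ℝ (X0 L))

theorem norm_jetMap_sq_le (hL : 0 < L) (ha : 0 < a) (hb : 0 < b) (hα₁ : 0 < α₁) (hα₂ : 0 < α₂)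
    (v : domain hL α₁ α₂) : ‖jetMap hL α₁ α₂ v‖ ^ 2
      ≤ ⟪generator hL a b α₁ α₂ v, smoothingForm hL a b α₂ v⟫ := by
  change ‖jet2 (v : X0 L)‖ ^ 2 ≤ _
  set m : ℝ := min (1 / 2) (min (3 * a / 2) (5 * b / 2)) with hm
  have hm0 : 0 < m := by positivity
  have m1 : m ≤ 1 / 2 := min_le_left _ _
  have m2 : m ≤ 3 * a / 2 := (min_le_right _ _).trans (min_le_left _ _)
  have m3 : m ≤ 5 * b / 2 := (min_le_right _ _).trans (min_le_right _ _)
  rw [smoothingForm, ← hm, smul_apply, sub_apply,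
    smul_apply, ContinuousLinearMap.id_apply, real_inner_smul_right,
    inner_sub_right, real_inner_smul_right, inner_generator_self, inner_generator_multiplier,
    inv_mul_eq_div, le_div_iff₀ hm0, norm_jet2_sq]
  set r := pointValue (weakDeriv 2 (v : X0 L).fst) L
  set l := pointValue (weakDeriv 2 (v : X0 L).fst) 0
  have e : L * (1 + α₂ ^ 2) / (2 * α₂) * -(α₂ * b * r ^ 2 + α₁ * b * l ^ 2)
      = -(b * L / 2 * (1 + α₂ ^ 2) * r ^ 2)
        - L * (1 + α₂ ^ 2) / (2 * α₂) * (α₁ * b * l ^ 2) := by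
    field_simp
    ring
  have h0 : 0 ≤ L * (1 + α₂ ^ 2) / (2 * α₂) * (α₁ * b * l ^ 2) := by positivity
  have h1 := mul_le_mul_of_nonneg_right m1 (sq_nonneg ‖(v : X0 L)‖)
  have h2 := mul_le_mul_of_nonneg_right m2 (by positivity :
    0 ≤ ‖weakDeriv 1 (v : X0 L).fst‖ ^ 2 + ‖weakDeriv 1 (v : X0 L).snd‖ ^ 2)
  have h3 := mul_le_mul_of_nonneg_right m3 (by positivity :
    0 ≤ ‖weakDeriv 2 (v : X0 L).fst‖ ^ 2 + ‖weakDeriv 2 (v : X0 L).snd‖ ^ 2)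
  rw [e]
  linarith

theorem inner_smoothingForm_comm (hL : 0 < L) (y z : X0 L) :
    ⟪y, smoothingForm hL a b α₂ z⟫ = ⟪smoothingForm hL a b α₂ y, z⟫ := by
  simp only [smoothingForm, smul_apply, sub_apply,
    ContinuousLinearMap.id_apply, real_inner_smul_right, real_inner_smul_left, inner_sub_right,
    inner_sub_left, inner_multiplier_comm]

theorem inner_smul_id_comm (c : ℝ) (y z : X0 L) :
    ⟪y, (c • ContinuousLinearMap.id ℝ (X0 L)) z⟫
      = ⟪(c • ContinuousLinearMap.id ℝ (X0 L)) y, z⟫ := by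
  simp only [smul_apply, ContinuousLinearMap.id_apply, real_inner_smul_right,
    real_inner_smul_left]

/-- The operator norm bound in the form of a square. -/
theorem norm_apply_le_sqrt_sq (S : X0 L →L[ℝ] X0 L) (x : X0 L) :
    ‖S x‖ ≤ Real.sqrt ‖S‖ ^ 2 * ‖x‖ := by
  rw [Real.sq_sqrt (norm_nonneg S)]
  exact S.le_opNorm x

end Estimates

/-- A limit of jets of functions of `H²₀(0,L)²` is the jet of a function of `H²₀(0,L)²`. -/
theorem jet2_eq_of_tendsto (hL : 0 < L) {ι : Type*} {l : Filter ι} [l.NeBot] {f : ι → X0 L}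
    {y : X0 L} {z : PiLp 2 (fun _ : Fin 3 => X0 L)}
    (hf : ∀ i, MemH20 (f i).fst ∧ MemH20 (f i).snd) (hy : Tendsto f l (𝓝 y))
    (hz : Tendsto (fun i => jet2 (f i)) l (𝓝 z)) :
    (MemH20 y.fst ∧ MemH20 y.snd) ∧ jet2 y = z := by
  have cf : Continuous fun y : X0 L => y.fst := by fun_prop
  have cs : Continuous fun y : X0 L => y.snd := by fun_prop
  have hk : ∀ k : Fin 3, Tendsto (fun i => jet2 (f i) k) l (𝓝 (z k)) := fun k =>
    ((PiLp.continuous_apply 2 (fun _ : Fin 3 => X0 L) k).tendsto z).comp hz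
  have hkf : ∀ k : Fin 3, Tendsto (fun i => weakDeriv (k : ℕ) (f i).fst) l (𝓝 (z k).fst) :=
    fun k => (cf.tendsto _).comp (hk k)
  have hks : ∀ k : Fin 3, Tendsto (fun i => weakDeriv (k : ℕ) (f i).snd) l (𝓝 (z k).snd) :=
    fun k => (cs.tendsto _).comp (hk k)
  obtain ⟨f0, f1, f2⟩ := memH20_of_tendsto hL (fun i => (hf i).1) ((cf.tendsto y).comp hy)
    (hkf 1) (hkf 2)
  obtain ⟨s0, s1, s2⟩ := memH20_of_tendsto hL (fun i => (hf i).2) ((cs.tendsto y).comp hy)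
    (hks 1) (hks 2)
  have z0 : y = z 0 := by
    refine tendsto_nhds_unique hy ((hk 0).congr fun i => ?_)
    change WithLp.toLp 2 (weakDeriv 0 (f i).fst, weakDeriv 0 (f i).snd) = f i
    rw [weakDeriv_zero, weakDeriv_zero]
    rfl
  refine ⟨⟨f0, s0⟩, ?_⟩
  ext1 k
  change WithLp.toLp 2 (weakDeriv (k : ℕ) y.fst, weakDeriv (k : ℕ) y.snd) = z k
  fin_cases k
  · change WithLp.toLp 2 (weakDeriv 0 y.fst, weakDeriv 0 y.snd) = z 0
    rw [weakDeriv_zero, weakDeriv_zero, ← z0]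
    rfl
  · change WithLp.toLp 2 (weakDeriv 1 y.fst, weakDeriv 1 y.snd) = z 1
    rw [f1, s1]
    rfl
  · change WithLp.toLp 2 (weakDeriv 2 y.fst, weakDeriv 2 y.snd) = z 2
    rw [f2, s2]
    rfl

/-- The primitive of a mild solution, as a curve in `D(A)`. -/
noncomputable def IsMildSolution.primitive {a b α₁ α₂ : ℝ} {y₀ : X0 L} {y : ℝ → X0 L}
    (hy : IsMildSolution a b α₁ α₂ y₀ y) (hL : 0 < L) (t : ℝ) : domain hL α₁ α₂ :=
  ⟨∫ s in (0 : ℝ)..max t 0, y s, hy.integral_mem _ (le_max_right _ _)⟩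

theorem IsMildSolution.coe_primitive {a b α₁ α₂ : ℝ} {y₀ : X0 L} {y : ℝ → X0 L}
    (hy : IsMildSolution a b α₁ α₂ y₀ y) (hL : 0 < L) {t : ℝ} (ht : 0 ≤ t) :
    (hy.primitive hL t : X0 L) = ∫ s in (0 : ℝ)..t, y s := by
  change (∫ s in (0 : ℝ)..max t 0, y s) = _
  rw [max_eq_left ht]

theorem IsMildSolution.isMildPair {a b α₁ α₂ : ℝ} {y₀ : X0 L} {y : ℝ → X0 L}
    (hy : IsMildSolution a b α₁ α₂ y₀ y) (hL : 0 < L) :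
    IsMildPair (generator hL a b α₁ α₂) y₀ (fun t => y (max t 0)) (hy.primitive hL) := by
  refine ⟨hy.continuousOn.comp_continuous (continuous_id.max continuous_const)
    fun s => mem_Ici.2 (le_max_right _ _), fun t ht => ?_, fun t ht => ?_⟩
  · rw [hy.coe_primitive hL ht]
    refine intervalIntegral.integral_congr fun s hs => ?_
    rw [uIcc_of_le ht] at hs
    simp only [max_eq_left hs.1]
  · change y (max t 0) = y₀ + opA a b (hy.primitive hL t : X0 L)
    rw [hy.coe_primitive hL ht, max_eq_left ht]
    exact hy.eq_add t ht

/-- The weighted identity follows from the energy identity by integration in time. -/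
theorem integral_sub_mul_eq {T : ℝ} (hT : 0 < T) {q : ℝ → ℝ}
    (hq : IntervalIntegrable q volume 0 T) :
    ∫ t in (0 : ℝ)..T, (T - t) * q t = ∫ t in (0 : ℝ)..T, ∫ s in (0 : ℝ)..t, q s := by
  have hq' : Integrable q (volume.restrict (Ioo 0 T)) :=
    (intervalIntegrable_iff_integrableOn_Ioo_of_le hT.le).1 hq
  have hQ := HasACDeriv.primitive hT hq' 0
  have hw : HasACDeriv T (fun t => T - t) (fun _ => -1) := by
    simpa using HasACDeriv.of_contDiff (L := T) (F := fun t => T - t)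
      (contDiff_const.sub contDiff_id)
  have h := (hw.mul hQ).integral_eq hT
  have i1 : IntegrableOn (fun t => (T - t) * q t) (Ioo 0 T) :=
    (intervalIntegrable_iff_integrableOn_Ioo_of_le hT.le).1
      (hq.continuousOn_mul (by fun_prop))
  have i2 : IntegrableOn (fun t => ∫ s in (0 : ℝ)..t, q s) (Ioo 0 T) := by
    have hc := hQ.continuousOn hT
    simp only [zero_add] at hc
    exact hc.integrableOn_Icc.mono_set Ioo_subset_Icc_self
  simp only [zero_add, sub_self, zero_mul, intervalIntegral.integral_same, mul_zero, neg_mul,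
    one_mul] at h
  have hs := (integral_add i2.neg i1).symm.trans h
  simp only [Pi.neg_apply, integral_neg] at hs
  rw [intervalIntegral.integral_of_le hT.le, intervalIntegral.integral_of_le hT.le,
    integral_Ioc_eq_integral_Ioo, integral_Ioc_eq_integral_Ioo]
  linarith

theorem intervalIntegrable_sq_coe (Z : Lp ℝ 2 (volume.restrict (Ioi (0 : ℝ)))) {T : ℝ}
    (hT : 0 ≤ T) : IntervalIntegrable (fun t => |Z t| ^ 2) volume 0 T := by
  rw [intervalIntegrable_iff_integrableOn_Ioc_of_le hT]
  exact (memLp_Ioc_of_memLp_Ioi (Lp.memLp Z) T).integrable_norm_pow two_ne_zero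

theorem IsMildSolution.exists_boundary_traces {a b α₁ α₂ : ℝ} {y₀ : X0 L} {y : ℝ → X0 L}
    (hL : 0 < L) (hb : 0 < b) (hα₁ : 0 < α₁) (hα₂ : 0 < α₂)
    (hy : IsMildSolution a b α₁ α₂ y₀ y) :
    ∃ g₀ gL : Lp ℝ 2 (volume.restrict (Ioi (0 : ℝ))),
      IsSecondDerivTrace y 0 g₀ ∧ IsSecondDerivTrace y L gL ∧
      ∀ T, 0 ≤ T → 1 / 2 * ‖y₀‖ ^ 2 - 1 / 2 * ‖y T‖ ^ 2
        = ∫ t in (0 : ℝ)..T, (α₂ * b * |gL t| ^ 2 + α₁ * b * |g₀ t| ^ 2) := by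
  have hp := hy.isMildPair hL
  have hA := inner_generator_self_nonpos (a := a) hL hb hα₁ hα₂
  have n0 := norm_boundaryTrace_left_sq_le (a := a) hL hb hα₁ hα₂
  have n1 := norm_boundaryTrace_right_sq_le (a := a) hL hb hα₁ hα₂
  obtain ⟨hv₀, g₀, ht₀, -⟩ := hp.exists_trace hA (Real.sqrt_nonneg _) (inner_smul_id_comm _)
    (norm_apply_le_sqrt_sq _) n0
  obtain ⟨hv₁, gL, ht₁, -⟩ := hp.exists_trace hA (Real.sqrt_nonneg _) (inner_smul_id_comm _)
    (norm_apply_le_sqrt_sq _) n1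
  refine ⟨g₀, gL, fun t ht => ?_, fun t ht => ?_, fun T hT => ?_⟩
  · have h := hp.integral_trace_eq (sq_le_of_le_inner (norm_apply_le_sqrt_sq _) n0) ht₀ ht
    rw [← hy.coe_primitive hL ht]
    exact h
  · have h := hp.integral_trace_eq (sq_le_of_le_inner (norm_apply_le_sqrt_sq _) n1) ht₁ ht
    rw [← hy.coe_primitive hL ht]
    exact h
  · have l0 := (tendsto_integral_norm_sq ht₀ hT).const_mul (α₁ * b)
    have l1 := (tendsto_integral_norm_sq ht₁ hT).const_mul (α₂ * b)
    have e0 := hp.tendsto_diffQuot (t := 0) le_rfl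
    rw [max_self, show y 0 = y₀ by simpa using hp.zero_eq] at e0
    have e1 := hp.tendsto_diffQuot hT
    rw [max_eq_left hT] at e1
    have l2 := ((e0.norm.pow 2).const_mul (1 / 2)).sub ((e1.norm.pow 2).const_mul (1 / 2))
    rw [intervalIntegral.integral_add ((intervalIntegrable_sq_coe gL hT).const_mul _)
      ((intervalIntegrable_sq_coe g₀ hT).const_mul _), intervalIntegral.integral_const_mul,
      intervalIntegral.integral_const_mul]
    refine tendsto_nhds_unique l2 ((l1.add l0).congr fun n => ?_)
    have hs := hp.isStrictSolution_diffQuot (step_pos n)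
    have hc : ∀ (N : domain hL α₁ α₂ →ₗ[ℝ] ℝ) (S : X0 L →L[ℝ] X0 L),
        (∀ v, ‖N v‖ ^ 2 ≤ ⟪generator hL a b α₁ α₂ v, S v⟫) →
        IntervalIntegrable (fun t => ‖N (diffQuot (hy.primitive hL) (step n) t)‖ ^ 2)
          volume 0 T := by
      intro N S hN
      refine ContinuousOn.intervalIntegrable (ContinuousOn.mono (s := Ici 0) ?_ ?_)
      · exact (continuousOn_apply_of_sq_le (sq_le_of_le_inner (norm_apply_le_sqrt_sq _) hN)
          hs.continuousOn hs.continuousOn_apply).norm.pow 2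
      · rw [uIcc_of_le hT]
        exact Icc_subset_Ici_self
    have hi := hs.integral_inner (ContinuousLinearMap.id ℝ (X0 L)) (fun _ _ => rfl) hT
    simp only [ContinuousLinearMap.id_apply, real_inner_self_eq_norm_sq,
      inner_generator_self] at hi
    rw [intervalIntegral.integral_neg] at hi
    rw [← intervalIntegral.integral_const_mul, ← intervalIntegral.integral_const_mul,
      ← intervalIntegral.integral_add ((hc _ _ n1).const_mul _) ((hc _ _ n0).const_mul _)]
    rw [← neg_sub, ← hi, neg_neg]
    refine intervalIntegral.integral_congr fun t _ => ?_
    simp only [Real.norm_eq_abs, sq_abs]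
    rfl

/-- The smoothing effect: mild solutions are square integrable in time with values in `H²₀`. -/
theorem IsMildSolution.memL2X2 {a b α₁ α₂ : ℝ} {y₀ : X0 L} {y : ℝ → X0 L}
    (hL : 0 < L) (ha : 0 < a) (hb : 0 < b) (hα₁ : 0 < α₁) (hα₂ : 0 < α₂)
    (hy : IsMildSolution a b α₁ α₂ y₀ y) (T : ℝ) :
    MemL2X2 T y ∧ normL2X2 T y ≤ Real.sqrt ‖smoothingForm hL a b α₂‖ * ‖y₀‖ := by
  have hp := hy.isMildPair hL
  obtain ⟨hv, Z, hZ, hZn⟩ := hp.exists_trace (inner_generator_self_nonpos (a := a) hL hb hα₁ hα₂)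
    (Real.sqrt_nonneg _) (inner_smoothingForm_comm hL) (norm_apply_le_sqrt_sq _)
    (norm_jetMap_sq_le hL ha hb hα₁ hα₂)
  obtain ⟨ns, hns, hae⟩ := IsMildPair.exists_seq_tendsto_ae hZ
  have key : ∀ᵐ t ∂(volume.restrict (Ioi (0 : ℝ))),
      (MemH20 (y t).fst ∧ MemH20 (y t).snd) ∧ jet2 (y t) = Z t := by
    filter_upwards [hae, ae_restrict_mem measurableSet_Ioi] with t ht ht0
    have h1 := (hp.tendsto_diffQuot (le_of_lt ht0)).comp hns.tendsto_atTop
    rw [max_eq_left (le_of_lt ht0)] at h1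
    refine jet2_eq_of_tendsto hL (fun i => ?_) h1 ht
    have hm := (diffQuot (hy.primitive hL) (step (ns i)) t).2
    exact ⟨hm.memH20_fst, hm.memH20_snd⟩
  have hle : volume.restrict (Ioo 0 T) ≤ volume.restrict (Ioi (0 : ℝ)) :=
    Measure.restrict_mono Ioo_subset_Ioi_self le_rfl
  have keyT := ae_mono hle key
  have heq : (fun t => jet2 (y t)) =ᵐ[volume.restrict (Ioo 0 T)] Z := by
    filter_upwards [keyT] with t ht using ht.2
  refine ⟨⟨by filter_upwards [keyT] with t ht using ht.1,
    (memLp_congr_ae heq).2 ((Lp.memLp Z).mono_measure hle)⟩, le_trans ?_ hZn⟩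
  rw [normL2X2, eLpNorm_congr_ae heq, Lp.norm_def]
  exact ENNReal.toReal_mono (Lp.eLpNorm_ne_top Z) (eLpNorm_mono_measure _ hle)

end DampedBoussinesq

theorem proposition2p3 (a b L α₂ : ℝ) (ha : 0 < a) (hb : 0 < b) (hL : 0 < L) (hα₂ : 0 < α₂) :
    (∀ α₁ : ℝ, 0 < α₁ → ∀ (y₀ : X0 L) (y : ℝ → X0 L), IsMildSolution a b α₁ α₂ y₀ y →
      ∃ g₀ gL : ℝ → ℝ, IsSecondDerivTrace y 0 g₀ ∧ IsSecondDerivTrace y L gL ∧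
        ∀ T : ℝ, 0 < T →
          MemLp g₀ 2 (volume.restrict (Ioo 0 T)) ∧ MemLp gL 2 (volume.restrict (Ioo 0 T)) ∧
          1 / 2 * ‖y₀‖ ^ 2 - 1 / 2 * ‖y T‖ ^ 2
            = ∫ t in (0 : ℝ)..T, (α₂ * b * |gL t| ^ 2 + α₁ * b * |g₀ t| ^ 2) ∧
          T / 2 * ‖y₀‖ ^ 2
            = 1 / 2 * (∫ t in (0 : ℝ)..T, ‖y t‖ ^ 2)
              + α₂ * b * (∫ t in (0 : ℝ)..T, (T - t) * |gL t| ^ 2)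
              + α₁ * b * (∫ t in (0 : ℝ)..T, (T - t) * |g₀ t| ^ 2)) ∧
    (∀ T : ℝ, 0 < T → ∃ C : ℝ, 0 < C ∧
      ∀ α₁ : ℝ, 0 < α₁ → ∀ (y₀ : X0 L) (y : ℝ → X0 L), IsMildSolution a b α₁ α₂ y₀ y →
        MemL2X2 T y ∧ normL2X2 T y ≤ C * ‖y₀‖) := by
  refine ⟨fun α₁ hα₁ y₀ y hy => ?_, fun T _ => ?_⟩
  · obtain ⟨g₀, gL, h₀, h₁, hE⟩ := hy.exists_boundary_traces hL hb hα₁ hα₂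
    refine ⟨g₀, gL, h₀, h₁, fun T hT => ?_⟩
    have hle : volume.restrict (Ioo 0 T) ≤ volume.restrict (Ioi (0 : ℝ)) :=
      Measure.restrict_mono Ioo_subset_Ioi_self le_rfl
    refine ⟨(Lp.memLp g₀).mono_measure hle, (Lp.memLp gL).mono_measure hle, hE T hT.le, ?_⟩
    have i0 := (intervalIntegrable_sq_coe g₀ hT.le).const_mul (α₁ * b)
    have i1 := (intervalIntegrable_sq_coe gL hT.le).const_mul (α₂ * b)
    have hw := integral_sub_mul_eq hT (i1.add i0)
    have hyc : ContinuousOn (fun t => 1 / 2 * ‖y t‖ ^ 2) (uIcc 0 T) := by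
      rw [uIcc_of_le hT.le]
      exact continuousOn_const.mul ((hy.continuousOn.mono Icc_subset_Ici_self).norm.pow 2)
    have e1 : ∫ t in (0 : ℝ)..T, ∫ s in (0 : ℝ)..t,
        (α₂ * b * |gL s| ^ 2 + α₁ * b * |g₀ s| ^ 2)
        = ∫ t in (0 : ℝ)..T, (1 / 2 * ‖y₀‖ ^ 2 - 1 / 2 * ‖y t‖ ^ 2) := by
      refine intervalIntegral.integral_congr fun t ht => ?_
      rw [uIcc_of_le hT.le] at ht
      exact (hE t ht.1).symm
    have e2 : ∫ t in (0 : ℝ)..T, (T - t) * (α₂ * b * |gL t| ^ 2 + α₁ * b * |g₀ t| ^ 2)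
        = α₂ * b * (∫ t in (0 : ℝ)..T, (T - t) * |gL t| ^ 2)
          + α₁ * b * (∫ t in (0 : ℝ)..T, (T - t) * |g₀ t| ^ 2) := by
      have c : ContinuousOn (fun t : ℝ => T - t) (uIcc 0 T) := by fun_prop
      rw [← intervalIntegral.integral_const_mul, ← intervalIntegral.integral_const_mul,
        ← intervalIntegral.integral_add
          (((intervalIntegrable_sq_coe gL hT.le).continuousOn_mul c).const_mul _)
          (((intervalIntegrable_sq_coe g₀ hT.le).continuousOn_mul c).const_mul _)]
      congr 1
      ext t
      ring
    rw [intervalIntegral.integral_sub intervalIntegrable_const hyc.intervalIntegrable,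
      intervalIntegral.integral_const, intervalIntegral.integral_const_mul, sub_zero,
      smul_eq_mul] at e1
    rw [add_assoc, ← e2]
    rw [hw.trans e1]
    ring
  -- The summand `1` only makes the constant positive.
  · refine ⟨Real.sqrt ‖smoothingForm hL a b α₂‖ + 1, by positivity,
      fun α₁ hα₁ y₀ y hy => ?_⟩
    obtain ⟨h1, h2⟩ := hy.memL2X2 hL ha hb hα₁ hα₂ T
    exact ⟨h1, h2.trans (mul_le_mul_of_nonneg_right (by linarith) (norm_nonneg _))⟩
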